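/- Let $E/\mathbb{Q}$ be an elliptic curve with full rational $2$-torsion, i.e. all points of $E(\overline{\mathbb{Q}})$ killed by $2$ are rational. Let $\rho_3^E : G_{\mathbb{Q}} \to \mathrm{Aut}(E[3]) \cong \mathrm{GL}_2(\mathbb{F}_3)$ be the representation given by the natural action of $G_{\mathbb{Q}} = \mathrm{Gal}(\overline{\mathbb{Q}}/\mathbb{Q})$ on the $3$-torsion group $E[3] \subset E(\overline{\mathbb{Q}})$. Then: 1. For every choice of an $\mathbb{F}_3$-basis of $E[3]$, the image $\rho_3^E(G_{\mathbb{Q}})$ is not contained in the normalizer of any split Cartan subgroup of $\mathrm{GL}_2(\mathbb{F}_3)$, where a split Cartan subgroup is a conjugate of the subgroup of diagonal matrices. 2. If $\rho_3^E$ is irreducible, then $\rho_3^E$ is strongly irreducible, i.e. its restriction to $\mathrm{Gal}(\overline{\mathbb{Q}}/\mathbb{Q}(\sqrt{-3}))$ is absolutely irreducible. -/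

import Mathlib

open scoped TensorProduct MatrixGroups

noncomputable section

namespace EllipticGalois

/-- The field of algebraic numbers, as an algebraic closure of the rationals. -/
abbrev Qbar : Type := AlgebraicClosure ℚ

/-- The absolute Galois group of the rationals. -/
abbrev GQ : Type := Qbar ≃ₐ[ℚ] Qbar

instance : DecidableEq Qbar := Classical.decEq _

/-- The group of points of `E` over the algebraic numbers. -/
abbrev GeomPoint (E : WeierstrassCurve ℚ) : Type :=
  WeierstrassCurve.Affine.Point (WeierstrassCurve.Affine.baseChange E Qbar)

/-- The group of rational points of `E`. -/
abbrev RatPoint (E : WeierstrassCurve ℚ) : Type :=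
  WeierstrassCurve.Affine.Point (WeierstrassCurve.Affine.baseChange E ℚ)

/-- The inclusion of the rational points in the points over the algebraic numbers. -/
def ratToGeom (E : WeierstrassCurve ℚ) : RatPoint E →+ GeomPoint E :=
  WeierstrassCurve.Affine.Point.map (W' := E) (R := ℚ) (S := ℚ) (Algebra.ofId ℚ Qbar)

/-- `E` has full rational 2-torsion: every point killed by 2 over the algebraic numbers
is a rational point. -/
def HasFullRationalTwoTorsion (E : WeierstrassCurve ℚ) : Prop :=
  ∀ P : GeomPoint E, (2 : ℕ) • P = 0 → ∃ Q : RatPoint E, ratToGeom E Q = P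

/-- The action of a Galois automorphism on points, coordinate by coordinate. -/
def galPoint (E : WeierstrassCurve ℚ) (σ : GQ) : GeomPoint E →+ GeomPoint E :=
  WeierstrassCurve.Affine.Point.map (W' := E) (R := ℚ) (S := ℚ) (σ : Qbar →ₐ[ℚ] Qbar)

/-- The `n`-torsion group `E[n]` over the algebraic numbers. -/
abbrev Torsion (E : WeierstrassCurve ℚ) (n : ℕ) : Type :=
  AddSubgroup.torsionBy (GeomPoint E) (n : ℤ)

instance (E : WeierstrassCurve ℚ) (n : ℕ) : Module (ZMod n) (Torsion E n) :=
  AddSubgroup.torsionBy.zmodModule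

theorem galPoint_mem (E : WeierstrassCurve ℚ) (n : ℕ) (σ : GQ) (P : Torsion E n) :
    galPoint E σ P ∈ AddSubgroup.torsionBy (GeomPoint E) (n : ℤ) := by
  rw [AddSubgroup.torsionBy.nsmul_iff, ← map_nsmul,
    AddSubgroup.torsionBy.nsmul_iff.mp P.2, map_zero]

/-- The action of a Galois automorphism on `E[n]`. -/
def galTorsion (E : WeierstrassCurve ℚ) (n : ℕ) (σ : GQ) : Torsion E n →+ Torsion E n :=
  ((galPoint E σ).comp (AddSubgroup.subtype _)).codRestrict _ (galPoint_mem E n σ)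

/-- The mod `n` Galois representation on `E[n]`. -/
def torsionRep (E : WeierstrassCurve ℚ) (n : ℕ) : Representation (ZMod n) GQ (Torsion E n) where
  toFun σ := (galTorsion E n σ).toZModLinearMap n
  map_one' := by
    ext P
    rcases P with ⟨_ | _, _⟩ <;> rfl
  map_mul' σ τ := by
    ext P
    rcases P with ⟨_ | _, _⟩ <;> rfl

/-- The mod `n` Galois representation in matrix form, with respect to a basis of `E[n]`. -/
def matrixRep (E : WeierstrassCurve ℚ) (n : ℕ) (b : Module.Basis (Fin 2) (ZMod n) (Torsion E n)) :
    GQ →* GL (Fin 2) (ZMod n) :=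
  (Units.map ((LinearMap.toMatrixAlgEquiv b : _ →* Matrix (Fin 2) (Fin 2) (ZMod n)))).comp
    (torsionRep E n).toHomUnits

/-- A split Cartan subgroup of `GL₂(F)` is a conjugate of the subgroup of diagonal matrices. -/
def IsSplitCartan {F : Type*} [Field F] (C : Subgroup (GL (Fin 2) F)) : Prop :=
  ∃ g : GL (Fin 2) F, ∀ h : GL (Fin 2) F, h ∈ C ↔ (g⁻¹ * h * g).val.IsDiag

/-- A representation over `k` is absolutely irreducible if it is irreducible after extension of
scalars to an algebraic closure of `k`. -/
def IsAbsolutelyIrreducible {k G V : Type*} [Field k] [Monoid G] [AddCommGroup V] [Module k V]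
    (ρ : Representation k G V) : Prop :=
  Representation.IsIrreducible
    (((Module.End.baseChangeHom k (AlgebraicClosure k) V :
      Module.End k V →* Module.End (AlgebraicClosure k) (AlgebraicClosure k ⊗[k] V)).comp ρ :
        Representation (AlgebraicClosure k) G (AlgebraicClosure k ⊗[k] V)))

/-- For odd `l`, the field obtained from the rationals by adjoining the square roots of
`l* = (-1)^((l-1)/2) l`. -/
def quadField (l : ℕ) : IntermediateField ℚ Qbar :=
  IntermediateField.adjoin ℚ {x : Qbar | x ^ 2 = (-1) ^ ((l - 1) / 2) * (l : Qbar)}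

/-- A representation of the absolute Galois group in residue characteristic `l` (an odd prime) is
strongly irreducible if its restriction to the absolute Galois group of `ℚ(√l*)` is absolutely
irreducible. -/
def IsStronglyIrreducible {V : Type*} (l : ℕ) [Fact l.Prime] [AddCommGroup V] [Module (ZMod l) V]
    (ρ : Representation (ZMod l) GQ V) : Prop :=
  IsAbsolutelyIrreducible (ρ.comp (quadField l).fixingSubgroup.subtype)

end EllipticGalois

end

/-! Everything turns on whether the discriminant Δ is a rational cube. The x-coordinates of the four
subgroups of order 3 are the roots of the 3-division polynomial, and b₄ - 3(x₀x₁ + x₂x₃) is a cube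
root of Δ (`cube_resolvent_eq_discriminant`). If every automorphism fixing √-3 acts on E[3] with
order dividing 8, none can multiply this root by a nontrivial cube root of unity, and Δ is a cube in
ℚ (`ThreeTorsionData.exists_cube_eq_discriminant`).

Let e₁, e₂, e₃ be the rational x-coordinates of the 2-torsion, so that Δ =
16((e₁-e₂)(e₂-e₃)(e₁-e₃))². If this is a cube, u = e₁-e₂ and v = e₂-e₃ solve 4uv(u+v) = w³, and
Euler's descent for x³ + y³ = 2z³ leaves only arithmetic progressions
(`exists_arithmetic_progression`). Thus E is a twist of y² = x³ - x, and Galois acts explicitly on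
the roots of 3z⁴ - 6z² - 1: some σ is a 4-cycle on them, and σ² together with a suitable τ fixing
√-3 generates a quaternion group on E[3].

Part 1: an element normalizing a split Cartan subgroup has fourth power 1, so Δ is a cube; its
square has an eigenvector, which the 4-cycle contradicts. Part 2: orders in GL₂(𝔽₃) divide 8 or 6.
If all orders over ℚ(√-3) divide 8, then Δ is a cube and the quaternion group is absolutely
irreducible. Otherwise there is an element of order 3 over ℚ(√-3); were the restriction not
absolutely irreducible, its fixed line would be stable under all of G_ℚ
(`isAbsolutelyIrreducible_of_order_three`). -/

open scoped QuadraticAlgebra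

namespace EllipticGalois

/-! ### Arithmetic of the Eisenstein integers -/

/-- The ring of Eisenstein integers, with `ω ^ 2 = -1 - ω`. -/
abbrev Eisenstein : Type := QuadraticAlgebra ℤ (-1) (-1)

namespace Eisenstein

theorem norm_eq (z : Eisenstein) : z.norm = z.re ^ 2 - z.re * z.im + z.im ^ 2 := by
  rw [QuadraticAlgebra.norm_def]; ring

theorem norm_nonneg (z : Eisenstein) : 0 ≤ z.norm := by
  rw [norm_eq]; nlinarith [sq_nonneg (z.re - z.im), sq_nonneg z.re, sq_nonneg z.im]

theorem norm_eq_zero {z : Eisenstein} (h : z.norm = 0) : z = 0 := by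
  rw [norm_eq] at h
  have h1 : z.im = 0 := by
    have : 3 * z.im ^ 2 ≤ 0 := by nlinarith [sq_nonneg (2 * z.re - z.im)]
    exact pow_eq_zero_iff two_ne_zero |>.mp (by nlinarith [sq_nonneg z.im])
  have h2 : z.re = 0 := by
    rw [h1] at h
    exact pow_eq_zero_iff two_ne_zero |>.mp (by linarith)
  ext <;> simp [h1, h2]

instance : IsDomain Eisenstein :=
  have : NoZeroDivisors Eisenstein := ⟨fun {x y} h => by
    have : x.norm * y.norm = 0 := by rw [← map_mul, h, QuadraticAlgebra.norm_zero]
    exact (mul_eq_zero.mp this).imp norm_eq_zero norm_eq_zero⟩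
  NoZeroDivisors.to_isDomain _

theorem round_div_error (a n : ℤ) (hn : 0 < n) :
    4 * (a - n * round ((a : ℚ) / n)) ^ 2 ≤ n ^ 2 := by
  have hn' : (0 : ℚ) < n := by exact_mod_cast hn
  have h := abs_sub_round ((a : ℚ) / n)
  have h2 : |(a : ℚ) - n * round ((a : ℚ) / n)| ≤ n / 2 := by
    have : (a : ℚ) - n * round ((a : ℚ) / n) = n * ((a : ℚ) / n - round ((a : ℚ) / n)) := by
      field_simp
    rw [this, abs_mul, abs_of_pos hn']
    nlinarith
  have h3 := sq_le_sq' (abs_le.mp h2).1 (abs_le.mp h2).2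
  have h4 : 4 * ((a : ℚ) - n * round ((a : ℚ) / n)) ^ 2 ≤ (n : ℚ) ^ 2 := by nlinarith
  exact_mod_cast h4

/-- The rounded quotient of two Eisenstein integers. -/
def quot (x y : Eisenstein) : Eisenstein :=
  ⟨round (((x * star y).re : ℚ) / (y.norm : ℤ)), round (((x * star y).im : ℚ) / (y.norm : ℤ))⟩

theorem norm_sub_mul_quot_lt (x : Eisenstein) {y : Eisenstein} (hy : y ≠ 0) :
    (x - y * quot x y).norm < y.norm := by
  have hpos : 0 < y.norm := lt_of_le_of_ne (norm_nonneg y) fun h => hy (norm_eq_zero h.symm)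
  have h1 := round_div_error (x * star y).re y.norm hpos
  have h2 := round_div_error (x * star y).im y.norm hpos
  have key : (x - y * quot x y).norm * y.norm =
      ((x * star y) - (y.norm : Eisenstein) * quot x y).norm := by
    rw [← QuadraticAlgebra.norm_star y, ← map_mul, QuadraticAlgebra.norm_star]
    congr 1
    have : ((y.norm : ℤ) : Eisenstein) = y * star y := QuadraticAlgebra.algebraMap_norm_eq_mul_star y
    rw [this]; ring
  rw [norm_eq (x * star y - _)] at key
  have e1 : ((x * star y) - (y.norm : Eisenstein) * quot x y).re =
      (x * star y).re - y.norm * round (((x * star y).re : ℚ) / (y.norm : ℤ)) := by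
    simp [quot]
  have e2 : ((x * star y) - (y.norm : Eisenstein) * quot x y).im =
      (x * star y).im - y.norm * round (((x * star y).im : ℚ) / (y.norm : ℤ)) := by
    simp [quot]
  rw [e1, e2] at key
  set r := (x * star y).re - y.norm * round (((x * star y).re : ℚ) / (y.norm : ℤ))
  set s := (x * star y).im - y.norm * round (((x * star y).im : ℚ) / (y.norm : ℤ))
  have : (x - y * quot x y).norm * y.norm < y.norm * y.norm := by
    rw [key]
    -- As (r + s)² ≥ 0, r² - rs + s² ≤ 3(r² + s²)/2 ≤ 3n²/4 with n the norm of `y`.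
    nlinarith [sq_nonneg (r + s)]
  exact lt_of_mul_lt_mul_right this hpos.le

instance : EuclideanDomain Eisenstein where
  __ := (inferInstance : CommRing Eisenstein)
  __ := (inferInstance : Nontrivial Eisenstein)
  quotient := quot
  quotient_zero x := by ext <;> simp [quot]
  remainder x y := x - y * quot x y
  quotient_mul_add_remainder_eq x y := by ring
  r := fun a b => a.norm.natAbs < b.norm.natAbs
  r_wellFounded := (measure fun z : Eisenstein => z.norm.natAbs).wf
  remainder_lt x {y} hy := by
    have := norm_sub_mul_quot_lt x hy
    have h0 := norm_nonneg (x - y * quot x y)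
    omega
  mul_left_not_lt x {y} hy := by
    have h0 : 1 ≤ y.norm.natAbs := by
      have : y.norm ≠ 0 := fun h => hy (norm_eq_zero h)
      omega
    rw [map_mul, Int.natAbs_mul]
    have := Nat.mul_le_mul_left x.norm.natAbs h0
    omega

theorem exists_associated_cube {x y z : Eisenstein} (h : IsCoprime x y) (e : x * y = z ^ 3) :
    ∃ w u : Eisenstein, u.norm = 1 ∧ x = u * w ^ 3 := by
  obtain ⟨w, u, hw⟩ := exists_associated_pow_of_mul_eq_pow' h e
  refine ⟨w, u, ?_, by rw [← hw, mul_comm]⟩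
  have := QuadraticAlgebra.isUnit_iff_norm_isUnit.mp u.isUnit
  rcases Int.isUnit_iff.mp this with h | h
  · exact h
  · have := norm_nonneg (u : Eisenstein); omega

theorem unit_cases {u : Eisenstein} (h : u.norm = 1) :
    u = ⟨1, 0⟩ ∨ u = ⟨-1, 0⟩ ∨ u = ⟨0, 1⟩ ∨ u = ⟨0, -1⟩ ∨ u = ⟨1, 1⟩ ∨ u = ⟨-1, -1⟩ := by
  rw [norm_eq] at h
  obtain ⟨a, b⟩ := u
  simp only at h
  have ha : -1 ≤ a ∧ a ≤ 1 := by constructor <;> nlinarith [sq_nonneg (2 * b - a)]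
  have hb : -1 ≤ b ∧ b ≤ 1 := by constructor <;> nlinarith [sq_nonneg (2 * a - b)]
  obtain ⟨ha1, ha2⟩ := ha
  obtain ⟨hb1, hb2⟩ := hb
  interval_cases a <;> interval_cases b <;> simp_all

/-- Since ω³ = 1, `w` may be replaced by ωw or ω²w, and one of the three has even ω-coordinate. Such
an element is p + q√-3, because √-3 = 1 + 2ω. -/
theorem exists_cube_even_im (w : Eisenstein) : ∃ p q : ℤ, w ^ 3 = (⟨p + q, 2 * q⟩ : Eisenstein) ^ 3 := by
  obtain ⟨a, b⟩ := w
  have key : ∀ c d : ℤ, Even d → ∃ p q : ℤ, (⟨c, d⟩ : Eisenstein) = ⟨p + q, 2 * q⟩ := by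
    rintro c d ⟨q, rfl⟩
    exact ⟨c - q, q, by ext <;> simp; ring⟩
  have h3 : (⟨0, 1⟩ : Eisenstein) ^ 3 = 1 := by
    ext <;> simp [pow_succ]
  have h3' : (⟨-1, -1⟩ : Eisenstein) ^ 3 = 1 := by
    ext <;> simp [pow_succ]
  rcases Int.even_or_odd b with hb | hb
  · obtain ⟨p, q, h⟩ := key a b hb
    exact ⟨p, q, by rw [h]⟩
  · rcases Int.even_or_odd a with ha | ha
    · obtain ⟨p, q, h⟩ := key (b - a) (-a) ha.neg
      refine ⟨p, q, ?_⟩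
      rw [← h, ← one_mul (_ ^ 3), ← h3', ← mul_pow]
      congr 1
      (ext <;> simp); ring
    · obtain ⟨p, q, h⟩ := key (-b) (a - b) (ha.sub_odd hb)
      refine ⟨p, q, ?_⟩
      rw [← h, ← one_mul (_ ^ 3), ← h3, ← mul_pow]
      congr 1
      (ext <;> simp); ring

end Eisenstein

/-! ### Cubes of the form a² + 3b² -/

open Eisenstein in
/-- A primitive representation of an odd cube by `a ^ 2 + 3 * b ^ 2` comes from the cube of an
element of `ℤ[√-3]`. -/
theorem exists_of_sq_add_three_mul_sq_eq_cube {a b d : ℤ} (hab : IsCoprime a b)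
    (hodd : Odd (a + b)) (h3 : ¬ (3 : ℤ) ∣ a) (h : a ^ 2 + 3 * b ^ 2 = d ^ 3) :
    ∃ p q : ℤ, a = p * (p ^ 2 - 9 * q ^ 2) ∧ b = 3 * q * (p ^ 2 - q ^ 2) := by
  -- The factors are a + b√-3 and a - b√-3.
  have hprod : (⟨a + b, 2 * b⟩ : Eisenstein) * ⟨a - b, -(2 * b)⟩ = (d : Eisenstein) ^ 3 := by
    have : (d : Eisenstein) ^ 3 = ((d ^ 3 : ℤ) : Eisenstein) := by push_cast; rfl
    rw [this, ← h]
    ext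
    · rw [QuadraticAlgebra.re_intCast]; simp; ring
    · rw [QuadraticAlgebra.im_intCast]; simp; ring
  have hd : Odd (d ^ 3) := by
    rw [← h]
    obtain ⟨k, hk⟩ := hodd
    have : a = 2 * k + 1 - b := by linarith
    subst this
    exact ⟨2 * k ^ 2 + 2 * k - 2 * k * b - b + 2 * b ^ 2, by ring⟩
  have hd3 : IsCoprime (6 : ℤ) (d ^ 3) := by
    have h2 : IsCoprime (2 : ℤ) (d ^ 3) := by
      obtain ⟨k, hk⟩ := hd
      exact ⟨-k, 1, by rw [hk]; ring⟩
    have h3' : IsCoprime (3 : ℤ) (d ^ 3) := by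
      rw [(Int.prime_three).coprime_iff_not_dvd, ← h]
      intro hdiv
      have : (3 : ℤ) ∣ a ^ 2 := (Int.dvd_add_left ⟨b ^ 2, rfl⟩).mp hdiv
      exact h3 (Int.prime_three.dvd_of_dvd_pow this)
    have := h2.mul_left h3'
    norm_num at this
    exact this
  obtain ⟨r, s, hrs⟩ := hab
  obtain ⟨m, n, hmn⟩ := hd3
  -- The ideal of the two factors contains 6a and 6b (⟨-1, -2⟩ is -√-3), hence 6, and also their
  -- product d³, which is prime to 6.
  have hcop : IsCoprime (⟨a + b, 2 * b⟩ : Eisenstein) ⟨a - b, -(2 * b)⟩ := by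
    have hr : ((r * a + s * b : ℤ) : Eisenstein) = 1 := by rw [hrs]; simp
    have hm : ((m * 6 + n * d ^ 3 : ℤ) : Eisenstein) = 1 := by rw [hmn]; simp
    push_cast at hr hm
    have e1 : (⟨a + b, 2 * b⟩ : Eisenstein) + ⟨a - b, -(2 * b)⟩ = 2 * (a : Eisenstein) := by
      ext <;> simp; ring
    have e2 : (⟨-1, -2⟩ : Eisenstein) * (⟨a + b, 2 * b⟩ - ⟨a - b, -(2 * b)⟩) =
        6 * (b : Eisenstein) := by
      ext <;> simp <;> ring
    refine ⟨(m : Eisenstein) * (3 * r + s * ⟨-1, -2⟩) + n * ⟨a - b, -(2 * b)⟩,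
      (m : Eisenstein) * (3 * r - s * ⟨-1, -2⟩), ?_⟩
    linear_combination (m : Eisenstein) * 3 * r * e1 + (m : Eisenstein) * s * e2 +
      (n : Eisenstein) * hprod + 6 * (m : Eisenstein) * hr + hm
  obtain ⟨w, u, hu, hw⟩ := exists_associated_cube hcop hprod
  obtain ⟨p, q, hpq⟩ := exists_cube_even_im w
  rw [hpq] at hw
  have hcube : (⟨p + q, 2 * q⟩ : Eisenstein) ^ 3 =
      ⟨p * (p ^ 2 - 9 * q ^ 2) + 3 * q * (p ^ 2 - q ^ 2), 2 * (3 * q * (p ^ 2 - q ^ 2))⟩ := by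
    ext <;> simp [pow_succ] <;> ring
  rw [hcube] at hw
  have hpar : Odd (a + b) := hodd
  generalize hP : p * (p ^ 2 - 9 * q ^ 2) = P at hw
  generalize hQ : 3 * q * (p ^ 2 - q ^ 2) = Q at hw
  have hre := congrArg QuadraticAlgebra.re hw
  have him := congrArg QuadraticAlgebra.im hw
  rcases unit_cases hu with rfl | rfl | rfl | rfl | rfl | rfl <;> simp at hre him
  · exact ⟨p, q, by omega, by omega⟩
  · exact ⟨-p, -q, by rw [neg_sq, neg_sq]; linarith, by rw [neg_sq, neg_sq]; linarith⟩
  -- The units ±ω, ±ω² would make a + b even.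
  all_goals (exfalso; obtain ⟨k, hk⟩ := hpar; omega)

/-! ### Euler's descent for x³ + y³ = 2z³ -/

theorem isCoprime_of_eq_add_mul {a b c : ℤ} (h : IsCoprime a b) (k : ℤ) (e : c = b + a * k) :
    IsCoprime a c :=
  e ▸ h.add_mul_left_right k

theorem isCube_of_mul_mul_eq_cube {a b c d : ℤ} (hab : IsCoprime a b) (hac : IsCoprime a c)
    (hbc : IsCoprime b c) (h : a * b * c = d ^ 3) :
    (∃ r, a = r ^ 3) ∧ (∃ s, b = s ^ 3) ∧ ∃ t, c = t ^ 3 := by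
  have h3 : Odd 3 := by decide
  refine ⟨Int.eq_pow_of_mul_eq_pow_odd_left (hab.mul_right hac) h3 (by rw [← h]; ring),
    Int.eq_pow_of_mul_eq_pow_odd_left (hab.symm.mul_right hbc) h3 (c := d) (by rw [← h]; ring),
    Int.eq_pow_of_mul_eq_pow_odd_left (hac.symm.mul_right hbc.symm) h3 (c := d)
      (by rw [← h]; ring)⟩

theorem isCoprime_sub_add {p q : ℤ} (h : IsCoprime p q) (hodd : Odd (p + q)) :
    IsCoprime (p - q) (p + q) := by
  obtain ⟨r, s, hrs⟩ := h
  obtain ⟨k, hk⟩ := hodd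
  refine ⟨-k * (r - s), 1 - k * (r + s), ?_⟩
  linear_combination hk - 2 * k * hrs

theorem odd_of_odd_cube {s : ℤ} (h : Odd (s ^ 3)) : Odd s :=
  (Int.odd_pow' (by decide)).mp h

/-- The inductive step of Euler's descent: cubes `s ^ 3`, `t ^ 3` with sum `2 * r ^ 3`. -/
theorem descent_step {s t r : ℤ} (hs : Odd (s ^ 3)) (ht : Odd (t ^ 3))
    (hst : IsCoprime (s ^ 3) (t ^ 3))
    (h : s ^ 3 + t ^ 3 = 2 * r ^ 3)
    (ih : ∀ a b : ℤ, IsCoprime a b → Odd (a + b) → a * (a ^ 2 + 3 * b ^ 2) = r ^ 3 →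
      a = 0 ∨ b = 0) : s = t ∨ s = -t := by
  have hs' := odd_of_odd_cube hs
  have ht' := odd_of_odd_cube ht
  -- Half-sum and half-difference: (a - b)³ + (a + b)³ = 2a(a² + 3b²).
  obtain ⟨a, ha⟩ := hs'.add_odd ht'
  obtain ⟨b, hb⟩ := ht'.sub_odd hs'
  have es : s = a - b := by omega
  have et : t = a + b := by omega
  subst es et
  have hcop : IsCoprime (a - b) (a + b) := by
    have := IsCoprime.pow_iff (m := 3) (n := 3) (by decide) (by decide) |>.mp hst
    exact this
  have hab : IsCoprime a b := by
    obtain ⟨u, v, huv⟩ := hcop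
    exact ⟨u + v, v - u, by linear_combination huv⟩
  rcases ih a b hab ht' (by linarith) with h | h
  · right; omega
  · left; omega

/-- If 3 ∤ a, both factors are cubes, and a = p(p - 3q)(p + 3q) splits into coprime cubes r³, s³, t³
with s³ + t³ = 2r³. If a = 3k, the equation is 9k(b² + 3k²) = z³; now b and k exchange roles and the
cubes are q, p - q, p + q. Either way r³ divides a, which gives a smaller solution. -/
theorem eq_zero_of_mul_sq_add_three_mul_sq_eq_cube (z : ℤ) : ∀ a b : ℤ, IsCoprime a b →
    Odd (a + b) → a * (a ^ 2 + 3 * b ^ 2) = z ^ 3 → a = 0 ∨ b = 0 := by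
  induction hn : (z ^ 3).natAbs using Nat.strong_induction_on generalizing z with
  | _ n ih =>
  intro a b hab hodd h
  by_contra! hne
  obtain ⟨ha, hb⟩ := hne
  have ha2 : 1 ≤ a ^ 2 := by have := sq_pos_of_ne_zero ha; omega
  have hb2 : 1 ≤ b ^ 2 := by have := sq_pos_of_ne_zero hb; omega
  -- The descent measure drops: a divisor of a is at most |a|, and |z³| = |a|(a² + 3b²) > |a|.
  have hsmall : ∀ m c : ℤ, m ≠ 0 → m ∣ a → m = c ^ 3 → (c ^ 3).natAbs < n := by
    intro m c _ hma hmc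
    have h1 : m.natAbs ≤ a.natAbs := Nat.le_of_dvd (by omega) (Int.natAbs_dvd_natAbs.mpr hma)
    have h2 : a.natAbs < n := by
      rw [← hn, ← h, Int.natAbs_mul]
      have : 2 ≤ (a ^ 2 + 3 * b ^ 2).natAbs := by omega
      nlinarith [show 0 < a.natAbs by omega]
    rw [← hmc]; omega
  by_cases h3 : (3 : ℤ) ∣ a
  · obtain ⟨k, rfl⟩ := h3
    have h3b : ¬ (3 : ℤ) ∣ b := fun hd =>
      Int.prime_three.not_isUnit (hab.isUnit_of_dvd' (dvd_mul_right 3 k) hd)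
    have hkb : IsCoprime k b := hab.of_mul_left_right
    have hodd' : Odd (b + k) := by
      obtain ⟨m, hm⟩ := hodd; exact ⟨m - k, by linarith⟩
    have hcop : IsCoprime (9 * k) (b ^ 2 + 3 * k ^ 2) := by
      have c1 : IsCoprime k (b ^ 2 + 3 * k ^ 2) := 
        isCoprime_of_eq_add_mul (hkb.pow_right (n := 2)) (3 * k) (by ring)
      have c2 : IsCoprime 3 (b ^ 2 + 3 * k ^ 2) :=
        ((Int.prime_three.coprime_iff_not_dvd.mpr h3b).pow_right (n := 2)).add_mul_left_right _
      have := (c2.mul_left c2).mul_left c1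
      norm_num at this
      exact this
    have hprod : 9 * k * (b ^ 2 + 3 * k ^ 2) = z ^ 3 := by rw [← h]; ring
    obtain ⟨c, hc⟩ := Int.eq_pow_of_mul_eq_pow_odd_left hcop (by decide : Odd 3) hprod
    obtain ⟨d, hd⟩ := Int.eq_pow_of_mul_eq_pow_odd_right hcop (by decide : Odd 3) hprod
    obtain ⟨p, q, hp, hq⟩ := exists_of_sq_add_three_mul_sq_eq_cube hkb.symm hodd' h3b hd
    have hqne : q ≠ 0 := by rintro rfl; apply ha; rw [hq]; ring
    have hpne : p ≠ 0 := by rintro rfl; apply hb; rw [hp]; ring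
    have hpq : IsCoprime p q := by
      rw [hp, hq] at hkb
      exact (hkb.symm.of_mul_left_left).of_mul_right_left.of_mul_right_right
    have hpqodd : Odd (p + q) := by
      rw [hp, hq] at hodd'
      rcases Int.even_or_odd (p + q) with ⟨m, hm⟩ | ho
      · exfalso
        have : p = m + m - q := by linarith
        subst this
        revert hodd'
        rw [imp_false, Int.not_odd_iff_even]
        exact ⟨4 * m ^ 3 - 12 * m * q ^ 2 + 4 * q ^ 3, by ring⟩
      · exact ho
    have h3c : (3 : ℤ) ∣ c := by
      apply Int.prime_three.dvd_of_dvd_pow (n := 3)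
      rw [← hc]; exact ⟨3 * k, by ring⟩
    obtain ⟨e, rfl⟩ := h3c
    have hcube : q * (p - q) * (p + q) = e ^ 3 := by
      rw [hq] at hc
      linarith
    have k1 : IsCoprime q (p - q) := isCoprime_of_eq_add_mul hpq.symm (-1) (by ring)
    have k2 : IsCoprime q (p + q) := isCoprime_of_eq_add_mul hpq.symm 1 (by ring)
    have k3 := isCoprime_sub_add hpq hpqodd
    obtain ⟨⟨r, hr⟩, ⟨s, hs⟩, ⟨t, ht⟩⟩ := isCube_of_mul_mul_eq_cube k1 k2 k3 hcube
    have hos : Odd (p - q) := by obtain ⟨m, hm⟩ := hpqodd; exact ⟨m - q, by linarith⟩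
    have hlt := hsmall q r hqne (by rw [hq]; exact ⟨9 * (p ^ 2 - q ^ 2), by ring⟩) hr
    have := descent_step (s := t) (t := -s) (r := r) (by rwa [← ht])
      (by rw [Odd.neg_pow (by decide), ← hs]; exact hos.neg)
      (by rw [Odd.neg_pow (by decide), ← hs, ← ht]; exact k3.symm.neg_right)
      (by rw [Odd.neg_pow (by decide), ← hs, ← ht, ← hr]; ring)
      (ih _ hlt r rfl)
    rcases this with e1 | e1
    · apply hpne
      have : t ^ 3 = -s ^ 3 := by rw [e1]; ring
      omega
    · apply hqne
      have : t ^ 3 = s ^ 3 := by rw [e1]; ring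
      omega
  · have hcop : IsCoprime a (a ^ 2 + 3 * b ^ 2) := by
      have c3 : IsCoprime a 3 := (Int.prime_three.coprime_iff_not_dvd.mpr h3).symm
      exact isCoprime_of_eq_add_mul (c3.mul_right (hab.pow_right (n := 2))) a (by ring)
    obtain ⟨c, hc⟩ := Int.eq_pow_of_mul_eq_pow_odd_left hcop (by decide : Odd 3) h
    obtain ⟨d, hd⟩ := Int.eq_pow_of_mul_eq_pow_odd_right hcop (by decide : Odd 3) h
    obtain ⟨p, q, hp, hq⟩ := exists_of_sq_add_three_mul_sq_eq_cube hab hodd h3 hd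
    have hqne : q ≠ 0 := by rintro rfl; apply hb; rw [hq]; ring
    have hpne : p ≠ 0 := by rintro rfl; apply ha; rw [hp]; ring
    have hp3 : ¬ (3 : ℤ) ∣ p := fun hd => h3 (by rw [hp]; exact hd.mul_right _)
    have hpq : IsCoprime p (3 * q) := by
      rw [hp, hq] at hab
      exact hab.of_mul_left_left.of_mul_right_left
    have hpqodd : Odd (p + 3 * q) := by
      rw [hp, hq] at hodd
      rcases Int.even_or_odd (p + 3 * q) with ⟨m, hm⟩ | ho
      · exfalso
        have : p = m + m - 3 * q := by linarith
        subst this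
        revert hodd
        rw [imp_false, Int.not_odd_iff_even]
        exact ⟨4 * m ^ 3 - 12 * m ^ 2 * q + 12 * q ^ 3, by ring⟩
      · exact ho
    have hcube : p * (p - 3 * q) * (p + 3 * q) = c ^ 3 := by
      rw [← hc, hp]; ring
    have k1 : IsCoprime p (p - 3 * q) := isCoprime_of_eq_add_mul hpq.neg_right 1 (by ring)
    have k2 : IsCoprime p (p + 3 * q) := isCoprime_of_eq_add_mul hpq 1 (by ring)
    have k3 := isCoprime_sub_add hpq hpqodd
    obtain ⟨⟨r, hr⟩, ⟨s, hs⟩, ⟨t, ht⟩⟩ := isCube_of_mul_mul_eq_cube k1 k2 k3 hcube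
    have hos : Odd (p - 3 * q) := by
      obtain ⟨m, hm⟩ := hpqodd; exact ⟨m - 3 * q, by linarith⟩
    have hlt := hsmall p r hpne (by rw [hp]; exact dvd_mul_right _ _) hr
    have := descent_step (s := s) (t := t) (r := r) (by rwa [← hs]) (by rwa [← ht])
      (by rwa [← hs, ← ht]) (by rw [← hs, ← ht, ← hr]; ring) (ih _ hlt r rfl)
    rcases this with e1 | e1
    · apply hqne
      have : s ^ 3 = t ^ 3 := by rw [e1]
      omega
    · apply hpne
      have : s ^ 3 = - t ^ 3 := by rw [e1]; ring
      omega

/-- Euler: two coprime odd cubes whose sum is twice a cube are equal up to sign. -/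
theorem eq_or_eq_neg_of_cube_add_cube_eq_two_mul_cube {x y z : ℤ} (hx : Odd (x ^ 3))
    (hy : Odd (y ^ 3)) (hxy : IsCoprime (x ^ 3) (y ^ 3)) (h : x ^ 3 + y ^ 3 = 2 * z ^ 3) :
    x = y ∨ x = -y :=
  descent_step hx hy hxy h (eq_zero_of_mul_sq_add_three_mul_sq_eq_cube z)

/-! ### The equation 4uv(u + v) = w³ -/

theorem cases_of_mul_mul_add_eq_two_mul_cube_of_even_add {U V W : ℤ} (hc : IsCoprime U V)
    (he : Even (U + V)) (h : U * V * (U + V) = 2 * W ^ 3) : U = V ∨ U + V = 0 := by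
  obtain ⟨m, hm⟩ := he
  have hcUm : IsCoprime U m := by
    have : IsCoprime U (m * 2) := isCoprime_of_eq_add_mul hc 1 (by linarith)
    exact this.of_mul_right_left
  have hcVm : IsCoprime V m := by
    have : IsCoprime V (m * 2) := isCoprime_of_eq_add_mul hc.symm 1 (by linarith)
    exact this.of_mul_right_left
  have hprod : U * V * m = W ^ 3 := by rw [hm] at h; linarith
  obtain ⟨⟨x, rfl⟩, ⟨y, rfl⟩, ⟨z, rfl⟩⟩ := isCube_of_mul_mul_eq_cube hc hcUm hcVm hprod
  have hodd : Odd (x ^ 3) := by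
    by_contra hx
    rw [Int.not_odd_iff_even] at hx
    have hy : Even (y ^ 3) := by
      obtain ⟨k, hk⟩ := hx; exact ⟨z ^ 3 - k, by linarith⟩
    have := hc.isUnit_of_dvd' hx.two_dvd hy.two_dvd
    exact Int.prime_two.not_isUnit this
  have hodd' : Odd (y ^ 3) := by
    obtain ⟨k, hk⟩ := hodd; exact ⟨z ^ 3 - k - 1, by linarith⟩
  rcases eq_or_eq_neg_of_cube_add_cube_eq_two_mul_cube hodd hodd' hc (z := z) (by linarith) with
    rfl | rfl
  · left; rfl
  · right; ring

/-- Exactly one of U, V, U + V is even. Up to sign the equation is symmetric in U, V, -(U + V), so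
the even term can be moved to the place of the sum. -/
theorem cases_of_mul_mul_add_eq_two_mul_cube {U V W : ℤ} (hc : IsCoprime U V)
    (hU : U ≠ 0) (hV : V ≠ 0) (hUV : U + V ≠ 0) (h : U * V * (U + V) = 2 * W ^ 3) :
    U = V ∨ U = -2 * V ∨ V = -2 * U := by
  rcases Int.even_or_odd (U + V) with he | ho
  · exact .inl ((cases_of_mul_mul_add_eq_two_mul_cube_of_even_add hc he h).resolve_right hUV)
  rcases Int.even_or_odd U with hu | hu
  · have hc' : IsCoprime (U + V) (-V) := by
      have := (hc.add_mul_left_left 1).neg_right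
      simpa using this
    have := cases_of_mul_mul_add_eq_two_mul_cube_of_even_add (W := -W) hc' (by simpa using hu)
      (by linear_combination -h)
    right; left
    rcases this with h | h
    · linarith
    · exact absurd (by linarith) hU
  · have hv : Even V := by
      obtain ⟨k, hk⟩ := ho; obtain ⟨l, hl⟩ := hu; exact ⟨k - l, by linarith⟩
    have hc' : IsCoprime (U + V) (-U) := by
      have := (hc.symm.add_mul_left_left 1).neg_right
      rw [add_comm V] at this
      simpa using this
    have := cases_of_mul_mul_add_eq_two_mul_cube_of_even_add (W := -W) hc' (by simpa using hv)
      (by linear_combination -h)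
    right; right
    rcases this with h | h
    · linarith
    · exact absurd (by linarith) hV

theorem exists_int_of_cube_eq {q : ℚ} {n : ℤ} (h : q ^ 3 = n) : ∃ m : ℤ, q = m := by
  have : IsIntegral ℤ q := IsIntegral.of_pow (n := 3) (by decide) (by
    rw [h]; exact isIntegral_algebraMap (R := ℤ) (A := ℚ) (x := n))
  obtain ⟨m, hm⟩ := IsIntegrallyClosed.isIntegral_iff.mp this
  exact ⟨m, by rw [← hm]; rfl⟩

/-- The rational solutions of `4 * u * v * (u + v) = w ^ 3`, which is the elliptic curve
`y ^ 2 = x ^ 3 + 1`. -/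
theorem cases_of_four_mul_mul_mul_add_eq_cube {u v w : ℚ} (hu : u ≠ 0) (hv : v ≠ 0)
    (huv : u + v ≠ 0) (h : 4 * u * v * (u + v) = w ^ 3) : u = v ∨ u = -2 * v ∨ v = -2 * u := by
  set r := u / v with hr
  set k := v / r.den with hk
  have hden : (r.den : ℚ) ≠ 0 := by exact_mod_cast r.den_nz
  have hk0 : k ≠ 0 := div_ne_zero hv hden
  have ev : v = (r.den : ℤ) * k := by rw [hk]; push_cast; field_simp
  have eu : u = r.num * k := by
    have h1 : u = r * v := by rw [hr]; field_simp
    rw [h1, hk]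
    nth_rewrite 1 [← Rat.num_div_den r]
    ring
  have hcop : IsCoprime r.num (r.den : ℤ) := by
    rw [Int.isCoprime_iff_nat_coprime]; simpa using r.reduced
  generalize r.num = U at eu hcop
  generalize (r.den : ℤ) = V at ev hcop
  clear_value k r
  subst eu ev
  have hU : U ≠ 0 := by rintro rfl; simp at hu
  have hV : V ≠ 0 := by rintro rfl; simp at hv
  have hUV : U + V ≠ 0 := by
    intro h0; apply huv; rw [← add_mul]
    have : (U : ℚ) + V = 0 := by exact_mod_cast h0
    rw [this, zero_mul]
  have hw : (w / k) ^ 3 = ((4 * U * V * (U + V) : ℤ) : ℚ) := by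
    rw [div_pow, ← h]; push_cast; field_simp
  obtain ⟨m, hm⟩ := exists_int_of_cube_eq hw
  rw [hm] at hw
  have hw' : m ^ 3 = 4 * U * V * (U + V) := by exact_mod_cast hw
  -- Evenness of m turns m³ = 4UV(U + V) into UV(U + V) = 2l³.
  have hm2 : (2 : ℤ) ∣ m := Int.prime_two.dvd_of_dvd_pow (n := 3) (by
    rw [hw']; exact ⟨2 * U * V * (U + V), by ring⟩)
  obtain ⟨l, rfl⟩ := hm2
  rcases cases_of_mul_mul_add_eq_two_mul_cube (W := l) hcop hU hV hUV (by linarith) with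
    h | h | h
  · left; rw [h]
  · right; left; rw [h]; push_cast; ring
  · right; right; rw [h]; push_cast; ring

/-! ### Element orders and split Cartan normalizers in GL₂(𝔽₃) -/

theorem matrix_zmod_three_pow_eq_one_aux : ∀ a b c d : ZMod 3, a * d - b * c ≠ 0 →
    (!![a, b; c, d] ^ 8 = 1 ∨ !![a, b; c, d] ^ 6 = 1) := by
  decide +kernel

theorem matrix_zmod_three_pow_eq_one (M : GL (Fin 2) (ZMod 3)) : M ^ 8 = 1 ∨ M ^ 6 = 1 := by
  have hdet : M.val 0 0 * M.val 1 1 - M.val 0 1 * M.val 1 0 ≠ 0 := by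
    rw [← Matrix.det_fin_two]
    exact ((Matrix.isUnit_iff_isUnit_det _).mp M.isUnit).ne_zero
  have := matrix_zmod_three_pow_eq_one_aux _ _ _ _ hdet
  rw [← Matrix.eta_fin_two] at this
  exact this.imp (fun h => Units.ext h) fun h => Units.ext h

/-- An invertible matrix conjugating diag(1, -1) to a diagonal matrix permutes the coordinate axes,
so it is diagonal or antidiagonal. Over 𝔽₃ its square is then diagonal with entries ±1. Testing this
one element of the Cartan subgroup is enough. -/
theorem normalizer_diagonal_aux : ∀ a b c d e f : ZMod 3, a * d - b * c ≠ 0 →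
    !![a, b; c, d] * !![1, 0; 0, -1] = !![e, 0; 0, f] * !![a, b; c, d] →
    (!![a, b; c, d] ^ 2) 1 0 = 0 ∧ !![a, b; c, d] ^ 4 = 1 := by
  decide +kernel

/-- The diagonal matrix with entries `1, -1`. -/
def diagOneNegOne : GL (Fin 2) (ZMod 3) :=
  ⟨!![1, 0; 0, -1], !![1, 0; 0, -1], by decide, by decide⟩

theorem IsSplitCartan.exists_conj_of_mem_normalizer {C : Subgroup (GL (Fin 2) (ZMod 3))}
    (hC : IsSplitCartan C) : ∃ g : GL (Fin 2) (ZMod 3),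
      ∀ M ∈ Subgroup.normalizer (C : Set (GL (Fin 2) (ZMod 3))),
        ((g⁻¹ * M * g).val ^ 2) 1 0 = 0 ∧ M ^ 4 = 1 := by
  obtain ⟨g, hg⟩ := hC
  refine ⟨g, fun M hM => ?_⟩
  have h1 : g * diagOneNegOne * g⁻¹ ∈ C := by
    rw [hg]
    have : g⁻¹ * (g * diagOneNegOne * g⁻¹) * g = diagOneNegOne := by group
    rw [this]
    intro i j hij
    fin_cases i <;> fin_cases j <;> simp_all [diagOneNegOne]
  have h2 : M * (g * diagOneNegOne * g⁻¹) * M⁻¹ ∈ C := (Subgroup.mem_normalizer_iff.mp hM _).mp h1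
  rw [hg] at h2
  set B := g⁻¹ * M * g with hB
  set D := g⁻¹ * (M * (g * diagOneNegOne * g⁻¹) * M⁻¹) * g with hD
  have hBD : B * diagOneNegOne = D * B := by rw [hB, hD]; group
  have hdet : B.val 0 0 * B.val 1 1 - B.val 0 1 * B.val 1 0 ≠ 0 := by
    rw [← Matrix.det_fin_two]
    exact ((Matrix.isUnit_iff_isUnit_det _).mp B.isUnit).ne_zero
  have hDval : D.val = !![D.val 0 0, 0; 0, D.val 1 1] := by
    conv_lhs => rw [Matrix.eta_fin_two D.val]
    rw [h2 (show (0 : Fin 2) ≠ 1 by decide), h2 (show (1 : Fin 2) ≠ 0 by decide)]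
  have hBD' : B.val * diagOneNegOne.val = D.val * B.val := congrArg Units.val hBD
  rw [hDval] at hBD'
  have := normalizer_diagonal_aux (B.val 0 0) (B.val 0 1) (B.val 1 0) (B.val 1 1)
    (D.val 0 0) (D.val 1 1) hdet (by rw [← Matrix.eta_fin_two]; exact hBD')
  rw [← Matrix.eta_fin_two] at this
  refine ⟨this.1, ?_⟩
  have h4 : B ^ 4 = 1 := Units.ext this.2
  have : M ^ 4 = g * B ^ 4 * g⁻¹ := by
    rw [hB]; simp only [pow_succ, pow_zero, one_mul]; group
  rw [this, h4]; group

/-- The square of an element normalizing a split Cartan subgroup has an eigenvector. -/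
theorem IsSplitCartan.exists_eigenvector_sq {C : Subgroup (GL (Fin 2) (ZMod 3))}
    (hC : IsSplitCartan C) {M : GL (Fin 2) (ZMod 3)}
    (hM : M ∈ Subgroup.normalizer (C : Set (GL (Fin 2) (ZMod 3)))) :
    ∃ v : Fin 2 → ZMod 3, v ≠ 0 ∧ ∃ c : ZMod 3, (M ^ 2).val.mulVec v = c • v := by
  obtain ⟨g, hg⟩ := hC.exists_conj_of_mem_normalizer
  have h0 := (hg M hM).1
  set B := g⁻¹ * M * g with hB
  refine ⟨g.val.mulVec ![1, 0], ?_, (B.val ^ 2) 0 0, ?_⟩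
  · intro h
    have h1 : (g⁻¹.val * g.val).mulVec ![1, 0] = 0 := by
      rw [← Matrix.mulVec_mulVec, h, Matrix.mulVec_zero]
    rw [← Units.val_mul, inv_mul_cancel, Units.val_one, Matrix.one_mulVec] at h1
    have := congrFun h1 0
    simp at this
  · have h1 : M ^ 2 * g = g * B ^ 2 := by rw [hB, sq, sq]; group
    rw [Matrix.mulVec_mulVec, ← Units.val_mul, h1, Units.val_mul, ← Matrix.mulVec_mulVec,
      ← Matrix.mulVec_smul]
    congr 1
    ext i
    rw [Units.val_pow_eq_pow_val]
    fin_cases i <;> simp [Matrix.mulVec, dotProduct, h0]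

theorem end_zmod_three_pow_eq_one {V : Type*} [AddCommGroup V] [Module (ZMod 3) V]
    (h2 : Module.finrank (ZMod 3) V = 2) (f : (Module.End (ZMod 3) V)ˣ) :
    f ^ 8 = 1 ∨ f ^ 6 = 1 := by
  have : Module.Finite (ZMod 3) V := Module.finite_of_finrank_eq_succ h2
  let b := Module.finBasisOfFinrankEq (ZMod 3) V h2
  let φ : (Module.End (ZMod 3) V)ˣ ≃* GL (Fin 2) (ZMod 3) :=
    Units.mapEquiv (LinearMap.toMatrixAlgEquiv b).toMulEquiv
  have := matrix_zmod_three_pow_eq_one (φ f)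
  rw [← map_pow, ← map_pow] at this
  exact this.imp (fun h => (map_eq_one_iff φ φ.injective).mp h)
    fun h => (map_eq_one_iff φ φ.injective).mp h

/-! ### Criteria for absolute irreducibility over 𝔽₃ -/

section Irreducible

theorem isIrreducible_of_forall {K G W : Type*} [Field K] [Monoid G] [AddCommGroup W] [Module K W]
    [Nontrivial W] {ρ : Representation K G W}
    (h : ∀ U : Submodule K W, (∀ g, ∀ v ∈ U, ρ g v ∈ U) → U = ⊥ ∨ U = ⊤) : ρ.IsIrreducible := by
  have : Nontrivial (Subrepresentation ρ) := ⟨⊥, ⊤, fun h0 =>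
    bot_ne_top (α := Submodule K W) (congrArg Subrepresentation.toSubmodule h0)⟩
  refine { eq_bot_or_eq_top := fun U => ?_ }
  exact (h U.toSubmodule fun g v hv => U.apply_mem_toSubmodule g hv).imp
    (fun h => Subrepresentation.toSubmodule_injective h)
    fun h => Subrepresentation.toSubmodule_injective h

theorem eq_bot_or_eq_top_of_isIrreducible {K G W : Type*} [Field K] [Monoid G] [AddCommGroup W]
    [Module K W] {ρ : Representation K G W} (h : ρ.IsIrreducible) (U : Submodule K W)
    (hU : ∀ g, ∀ v ∈ U, ρ g v ∈ U) : U = ⊥ ∨ U = ⊤ := by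
  have := h.eq_bot_or_eq_top ⟨U, fun g v hv => hU g v hv⟩
  exact this.imp (fun h => congrArg Subrepresentation.toSubmodule h)
    fun h => congrArg Subrepresentation.toSubmodule h

/-- A two-dimensional representation without a common eigenvector is irreducible. -/
theorem isIrreducible_of_no_eigenvector {K G W : Type*} [Field K] [Monoid G] [AddCommGroup W]
    [Module K W] (h2 : Module.finrank K W = 2) {ρ : Representation K G W}
    (h : ∀ w : W, w ≠ 0 → ¬ ∀ g, ∃ c : K, ρ g w = c • w) : ρ.IsIrreducible := by
  have hfin : Module.Finite K W := Module.finite_of_finrank_eq_succ h2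
  have : Nontrivial W := Module.nontrivial_of_finrank_pos (R := K) (by omega)
  refine isIrreducible_of_forall fun U hU => ?_
  by_contra! hne
  have h1 : Module.finrank K U = 1 := by
    have hlt := Submodule.finrank_lt hne.2
    have : Module.finrank K U ≠ 0 := fun h0 => hne.1 (Submodule.finrank_eq_zero.mp h0)
    omega
  obtain ⟨w, hw0, hw⟩ := finrank_eq_one_iff'.mp h1
  refine h w (by simpa using hw0) fun g => ?_
  obtain ⟨c, hc⟩ := hw ⟨ρ g w, hU g w w.2⟩
  exact ⟨c, (congrArg Subtype.val hc).symm⟩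

variable {V : Type*} [AddCommGroup V] [Module (ZMod 3) V]

theorem isAbsolutelyIrreducible_of_no_eigenvector {H : Type*} [Monoid H]
    (h2 : Module.finrank (ZMod 3) V = 2) {ρ : Representation (ZMod 3) H V}
    (h : ∀ w : AlgebraicClosure (ZMod 3) ⊗[ZMod 3] V, w ≠ 0 →
      ¬ ∀ g, ∃ c : AlgebraicClosure (ZMod 3),
        (ρ g).baseChange (AlgebraicClosure (ZMod 3)) w = c • w) :
    IsAbsolutelyIrreducible ρ :=
  isIrreducible_of_no_eigenvector (by rw [Module.finrank_baseChange, h2]) h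

theorem algebraicClosure_three_eq_zero : (3 : AlgebraicClosure (ZMod 3)) = 0 := by
  have : (3 : ZMod 3) = 0 := by decide
  have := congrArg (algebraMap (ZMod 3) (AlgebraicClosure (ZMod 3))) this
  rwa [map_ofNat, map_zero] at this

/-- Two elements generating a quaternion group act absolutely irreducibly. -/
theorem isAbsolutelyIrreducible_of_quaternion {H : Type*} [Monoid H]
    (h2 : Module.finrank (ZMod 3) V = 2) {ρ : Representation (ZMod 3) H V} (a b : H)
    (ha : ρ a * ρ a = -1) (hb : ρ b * ρ b = -1) (hab : ρ a * ρ b * (ρ a * ρ b) = -1) :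
    IsAbsolutelyIrreducible ρ := by
  refine isAbsolutelyIrreducible_of_no_eigenvector h2 fun w hw h => ?_
  set k := AlgebraicClosure (ZMod 3)
  let φ : Module.End (ZMod 3) V →ₐ[ZMod 3] Module.End k (k ⊗[ZMod 3] V) :=
    Module.End.baseChangeHom (ZMod 3) k V
  obtain ⟨c, hc⟩ := h a
  obtain ⟨d, hd⟩ := h b
  have hc : φ (ρ a) w = c • w := hc
  have hd : φ (ρ b) w = d • w := hd
  have ha' := congrArg (fun f => φ f w) ha
  have hb' := congrArg (fun f => φ f w) hb
  have hab' := congrArg (fun f => φ f w) hab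
  simp only [map_mul, Module.End.mul_apply, hc, hd, map_smul, map_neg, map_one,
    LinearMap.neg_apply, Module.End.one_apply, smul_smul] at ha' hb' hab'
  rw [← neg_one_smul k w] at ha' hb' hab'
  have e1 := smul_left_injective k hw ha'
  have e2 := smul_left_injective k hw hb'
  have e3 := smul_left_injective k hw hab'
  -- The eigenvalues satisfy c² = d² = (cd)² = -1, whereas c²d² = 1; hence 2 = 0 in characteristic
  -- 3.
  have h20 : (2 : k) = 0 := by linear_combination e3 - d * d * e1 + e2
  have h30 : (3 : k) = 0 := algebraicClosure_three_eq_zero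
  exact one_ne_zero (α := k) (by linear_combination h30 - h20)

theorem one_tmul_injective :
    Function.Injective fun v : V => (1 : AlgebraicClosure (ZMod 3)) ⊗ₜ[ZMod 3] v :=
  Module.FaithfullyFlat.tensorProduct_mk_injective V

/-- A representation with a unipotent element of order 3 in a normal subgroup is reducible as soon
as the restriction to this subgroup is not absolutely irreducible. -/
theorem isAbsolutelyIrreducible_of_order_three {G : Type*} [Group G]
    (h2 : Module.finrank (ZMod 3) V = 2) {ρ : Representation (ZMod 3) G V} (hρ : ρ.IsIrreducible)
    (N : Subgroup G) [N.Normal] {h : G} (hN : h ∈ N) (h3 : ρ h ^ 3 = 1) (h1 : ρ h ≠ 1) :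
    IsAbsolutelyIrreducible (ρ.comp N.subtype) := by
  refine isAbsolutelyIrreducible_of_no_eigenvector h2 fun w hw hev => ?_
  have hfin : Module.Finite (ZMod 3) V := Module.finite_of_finrank_eq_succ h2
  set k := AlgebraicClosure (ZMod 3)
  have h30 : (3 : k) = 0 := algebraicClosure_three_eq_zero
  -- In characteristic 3, c³ - 1 = (c - 1)³.
  have hcube : ∀ c : k, c ^ 3 = 1 → c = 1 := fun c hc => by
    have : (c - 1) ^ 3 = 0 := by
      linear_combination hc - (c ^ 2 - c) * h30
    exact sub_eq_zero.mp (pow_eq_zero_iff (by decide) |>.mp this)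
  let φ : Module.End (ZMod 3) V →ₐ[ZMod 3] Module.End k (k ⊗[ZMod 3] V) :=
    Module.End.baseChangeHom (ZMod 3) k V
  have hφ : ∀ (f : Module.End (ZMod 3) V) (v : V), φ f (1 ⊗ₜ v) = 1 ⊗ₜ f v := fun f v => rfl
  have hfix : ∀ (u : k ⊗[ZMod 3] V), u ≠ 0 → ∀ (f : Module.End (ZMod 3) V) (c : k), f ^ 3 = 1 →
      φ f u = c • u → φ f u = u := by
    intro u hu f c hf hc
    have e : φ (f ^ 3) u = c ^ 3 • u := by
      simp only [pow_succ, pow_zero, one_mul, map_mul, Module.End.mul_apply, hc, map_smul,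
        smul_smul, mul_assoc]
    rw [hf, map_one, Module.End.one_apply] at e
    have : c ^ 3 = 1 := smul_left_injective k hu (by simpa using e.symm)
    rw [hc, hcube c this, one_smul]
  obtain ⟨v₂, hv₂⟩ : ∃ v, ρ h v ≠ v := by
    by_contra! hall
    exact h1 (LinearMap.ext hall)
  obtain ⟨v, hv0, hv⟩ : ∃ v, v ≠ 0 ∧ ρ h v = v := by
    by_contra! hall
    have hinj : Function.Injective (ρ h - 1 : Module.End (ZMod 3) V) := by
      rw [injective_iff_map_eq_zero]
      intro v hv
      by_contra hv0
      exact hall v hv0 (sub_eq_zero.mp hv)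
    have hnil : (ρ h - 1) ^ 3 = 0 := by
      have h30 : (3 : Module.End (ZMod 3) V) = 0 := by
        ext v
        have : 3 • v = 0 := by
          rw [← Nat.cast_smul_eq_nsmul (ZMod 3), CharP.cast_eq_zero, zero_smul]
        simpa using this
      have : (ρ h - 1) ^ 3 = ρ h ^ 3 - 1 - 3 * (ρ h ^ 2 - ρ h) := by noncomm_ring
      rw [this, h3, h30]; simp
    have hinj3 : Function.Injective ((ρ h - 1) ^ 3 : Module.End (ZMod 3) V) := by
      rw [Module.End.coe_pow]; exact hinj.iterate 3
    rw [hnil] at hinj3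
    exact hv₂ (hinj3 (by simp))
  have hw1 : φ (ρ h) w = w := by
    obtain ⟨c, hc⟩ := hev ⟨h, hN⟩
    exact hfix w hw (ρ h) c h3 hc
  have hv1 : (1 : k) ⊗ₜ[ZMod 3] v ≠ 0 := fun h0 =>
    hv0 (one_tmul_injective (h0.trans (TensorProduct.tmul_zero V 1).symm))
  -- The space fixed by `h` is a line containing both w and 1 ⊗ v, so the common eigenvector is
  -- defined over 𝔽₃ up to a scalar.
  obtain ⟨a, ha⟩ : ∃ a : k, a • ((1 : k) ⊗ₜ[ZMod 3] v) = w := by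
    let L := LinearMap.ker (φ (ρ h) - 1)
    have hLtop : L ≠ ⊤ := by
      intro ht
      have : (1 : k) ⊗ₜ[ZMod 3] v₂ ∈ L := ht ▸ Submodule.mem_top
      rw [LinearMap.mem_ker, LinearMap.sub_apply, sub_eq_zero, hφ] at this
      exact hv₂ (one_tmul_injective this)
    have hlt := Submodule.finrank_lt hLtop
    rw [Module.finrank_baseChange, h2] at hlt
    have hvL : (1 : k) ⊗ₜ[ZMod 3] v ∈ L := by
      rw [LinearMap.mem_ker, LinearMap.sub_apply, sub_eq_zero, hφ, hv]; rfl
    have hwL : w ∈ L := by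
      rw [LinearMap.mem_ker, LinearMap.sub_apply, sub_eq_zero, hw1]; rfl
    have hL1 : Module.finrank k L = 1 := by
      have : Module.finrank k L ≠ 0 := fun h0 => by
        rw [Submodule.finrank_eq_zero.mp h0] at hvL
        exact hv1 (by simpa using hvL)
      omega
    obtain ⟨a, ha⟩ := (finrank_eq_one_iff_of_nonzero' (⟨_, hvL⟩ : L)
      (fun h0 => hv1 (congrArg Subtype.val h0))).mp hL1 ⟨w, hwL⟩
    exact ⟨a, congrArg Subtype.val ha⟩
  have ha0 : a ≠ 0 := by rintro rfl; exact hw (by rw [← ha, zero_smul])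
  -- By normality g⁻¹hg lies in N, so v is an eigenvector of it; the eigenvalue is a cube root of
  -- unity, hence 1.
  have hline : ∀ g, ρ h (ρ g v) = ρ g v := by
    intro g
    have hmem : g⁻¹ * h * g ∈ N := by
      simpa using (inferInstance : N.Normal).conj_mem h hN g⁻¹
    obtain ⟨c, hc⟩ := hev ⟨_, hmem⟩
    have hc : φ (ρ (g⁻¹ * h * g)) w = c • w := hc
    rw [← ha, map_smul, smul_comm c a] at hc
    have hc := smul_right_injective _ ha0 hc
    have hc3 : ρ (g⁻¹ * h * g) ^ 3 = 1 := by
      have : (g⁻¹ * h * g) ^ 3 = g⁻¹ * h ^ 3 * g := by simp only [pow_succ, pow_zero]; group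
      rw [← map_pow, this, map_mul, map_mul, map_pow, h3, mul_one, ← map_mul, inv_mul_cancel,
        map_one]
    have hfx := one_tmul_injective (hfix _ hv1 _ c hc3 hc)
    have : ρ h (ρ g v) = ρ g (ρ (g⁻¹ * h * g) v) := by
      rw [← Module.End.mul_apply, ← Module.End.mul_apply, ← map_mul, ← map_mul]
      congr 2; group
    rw [this]
    exact congrArg (ρ g) hfx
  have hstable : ∀ x, ρ h x = x → ∃ c : ZMod 3, c • v = x := by
    intro x hx
    let L := LinearMap.ker (ρ h - 1)
    have hLtop : L ≠ ⊤ := by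
      intro ht
      have : v₂ ∈ L := ht ▸ Submodule.mem_top
      rw [LinearMap.mem_ker, LinearMap.sub_apply, sub_eq_zero] at this
      exact hv₂ this
    have hlt := Submodule.finrank_lt hLtop
    rw [h2] at hlt
    have hmem : ∀ x, ρ h x = x → x ∈ L := fun x hx => by
      rw [LinearMap.mem_ker, LinearMap.sub_apply, sub_eq_zero]; exact hx
    have hL1 : Module.finrank (ZMod 3) L = 1 := by
      have : Module.finrank (ZMod 3) L ≠ 0 := fun h0 => by
        have := hmem v hv
        rw [Submodule.finrank_eq_zero.mp h0] at this
        exact hv0 (by simpa using this)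
      omega
    obtain ⟨a, ha⟩ := (finrank_eq_one_iff_of_nonzero' (⟨v, hmem v hv⟩ : L)
      (fun h0 => hv0 (congrArg Subtype.val h0))).mp hL1 ⟨x, hmem x hx⟩
    exact ⟨a, congrArg Subtype.val ha⟩
  -- The fixed line of `h` is stable under all of G, against irreducibility.
  rcases eq_bot_or_eq_top_of_isIrreducible hρ (LinearMap.ker (ρ h - 1)) (by
    intro g x hx
    rw [LinearMap.mem_ker, LinearMap.sub_apply, sub_eq_zero] at hx ⊢
    obtain ⟨c, rfl⟩ := hstable x hx
    rw [map_smul, map_smul, hline]; rfl) with hbot | htop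
  · have : v ∈ LinearMap.ker (ρ h - 1) := by
      rw [LinearMap.mem_ker, LinearMap.sub_apply, sub_eq_zero]; exact hv
    rw [hbot] at this
    exact hv0 (by simpa using this)
  · have : v₂ ∈ LinearMap.ker (ρ h - 1) := htop ▸ Submodule.mem_top
    rw [LinearMap.mem_ker, LinearMap.sub_apply, sub_eq_zero] at this
    exact hv₂ this

end Irreducible

/-! ### Cubics and quartics over an algebraically closed field -/

section Vieta

variable {F : Type*} [Field F] [IsAlgClosed F]

theorem exists_roots_cubic (p q r : F) : ∃ x y z : F,
    p = -(x + y + z) ∧ q = x * y + x * z + y * z ∧ r = -(x * y * z) := by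
  obtain ⟨x, hx⟩ := IsAlgClosed.exists_root
    (Polynomial.X ^ 3 + Polynomial.C p * Polynomial.X ^ 2 + Polynomial.C q * Polynomial.X +
      Polynomial.C r : Polynomial F) (by
      have : (Polynomial.X ^ 3 + Polynomial.C p * Polynomial.X ^ 2 + Polynomial.C q * Polynomial.X +
        Polynomial.C r : Polynomial F).degree = 3 := by compute_degree!
      rw [this]; decide)
  simp only [Polynomial.IsRoot, Polynomial.eval_add, Polynomial.eval_mul, Polynomial.eval_pow,
    Polynomial.eval_X, Polynomial.eval_C] at hx
  obtain ⟨y, hy⟩ := IsAlgClosed.exists_root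
    (Polynomial.X ^ 2 + Polynomial.C (p + x) * Polynomial.X +
      Polynomial.C (q + x * (p + x)) : Polynomial F) (by
      have : (Polynomial.X ^ 2 + Polynomial.C (p + x) * Polynomial.X +
        Polynomial.C (q + x * (p + x)) : Polynomial F).degree = 2 := by compute_degree!
      rw [this]; decide)
  simp only [Polynomial.IsRoot, Polynomial.eval_add, Polynomial.eval_mul, Polynomial.eval_pow,
    Polynomial.eval_X, Polynomial.eval_C] at hy
  refine ⟨x, y, -p - x - y, by ring, ?_, ?_⟩
  · linear_combination hy
  · linear_combination hx - x * hy

theorem exists_roots_quartic (p q r s : F) : ∃ x y z w : F,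
    p = -(x + y + z + w) ∧ q = x * y + x * z + x * w + y * z + y * w + z * w ∧
      r = -(x * y * z + x * y * w + x * z * w + y * z * w) ∧ s = x * y * z * w := by
  obtain ⟨x, hx⟩ := IsAlgClosed.exists_root
    (Polynomial.X ^ 4 + Polynomial.C p * Polynomial.X ^ 3 + Polynomial.C q * Polynomial.X ^ 2 +
      Polynomial.C r * Polynomial.X + Polynomial.C s : Polynomial F) (by
      have : (Polynomial.X ^ 4 + Polynomial.C p * Polynomial.X ^ 3 +
        Polynomial.C q * Polynomial.X ^ 2 + Polynomial.C r * Polynomial.X + Polynomial.C s :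
          Polynomial F).degree = 4 := by compute_degree!
      rw [this]; decide)
  simp only [Polynomial.IsRoot, Polynomial.eval_add, Polynomial.eval_mul, Polynomial.eval_pow,
    Polynomial.eval_X, Polynomial.eval_C] at hx
  obtain ⟨y, z, w, h1, h2, h3⟩ := exists_roots_cubic (p + x) (q + x * (p + x))
    (r + x * (q + x * (p + x)))
  refine ⟨x, y, z, w, by linear_combination h1, by linear_combination h2 - x * h1,
    by linear_combination h3 - x * h2, by linear_combination hx - x * h3⟩

end Vieta

/-! ### The 3-division polynomial and its cubic resolvent -/

open WeierstrassCurve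

section Curve

variable {F : Type*} [Field F] {W : Affine F}

/-- For P not of order 2, 3P = 0 means x(2P) = x(P), and x(2P) - x(P) is minus the 3-division
polynomial over D², D = 2y + a₁x + a₃. If P has order 2 then D = 0, and a zero of the polynomial
would make P singular. -/
theorem three_nsmul_eq_zero_iff [DecidableEq F] {x y : F} (h : W.Nonsingular x y) :
    3 • Affine.Point.some x y h = 0 ↔
      3 * x ^ 4 + W.b₂ * x ^ 3 + 3 * W.b₄ * x ^ 2 + 3 * W.b₆ * x + W.b₈ = 0 := by
  obtain ⟨heq, hns⟩ := (Affine.nonsingular_iff' x y).mp h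
  have heq := (Affine.equation_iff' x y).mp heq
  set P := Affine.Point.some x y h with hP
  have hP0 : P ≠ 0 := Affine.Point.some_ne_zero h
  have h3 : 3 • P = P + P + P := by rw [succ_nsmul, two_nsmul]
  have key : (3 * x ^ 2 + 2 * W.a₂ * x + W.a₄ - W.a₁ * y) ^ 2 +
      W.a₁ * (3 * x ^ 2 + 2 * W.a₂ * x + W.a₄ - W.a₁ * y) * (2 * y + W.a₁ * x + W.a₃) -
      (W.a₂ + 3 * x) * (2 * y + W.a₁ * x + W.a₃) ^ 2 =
      -(3 * x ^ 4 + W.b₂ * x ^ 3 + 3 * W.b₄ * x ^ 2 + 3 * W.b₆ * x + W.b₈) := by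
    simp only [WeierstrassCurve.b₂, WeierstrassCurve.b₄, WeierstrassCurve.b₆, WeierstrassCurve.b₈]
    linear_combination -(W.a₁ ^ 2 + 4 * W.a₂ + 12 * x) * heq
  by_cases hy : y = W.negY x y
  · have hD : 2 * y + W.a₁ * x + W.a₃ = 0 := by
      rw [Affine.negY] at hy; linear_combination hy
    have h2 : P + P = 0 := Affine.Point.add_self_of_Y_eq hy
    rw [h3, h2, zero_add]
    refine ⟨fun h0 => absurd h0 hP0, fun h0 => ?_⟩
    rw [hD, h0] at key
    have hm : 3 * x ^ 2 + 2 * W.a₂ * x + W.a₄ - W.a₁ * y = 0 := by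
      have : (3 * x ^ 2 + 2 * W.a₂ * x + W.a₄ - W.a₁ * y) ^ 2 = 0 := by linear_combination key
      exact pow_eq_zero_iff two_ne_zero |>.mp this
    rcases hns with hns | hns
    · exact absurd (by linear_combination -hm) hns
    · exact absurd hD hns
  · have hD : y - W.negY x y ≠ 0 := sub_ne_zero.mpr hy
    have hDeq : y - W.negY x y = 2 * y + W.a₁ * x + W.a₃ := by rw [Affine.negY]; ring
    have hadd := Affine.Point.add_self_of_Y_ne (h₁ := h) hy
    have hx : W.addX x x (W.slope x x y y) = x ↔
        3 * x ^ 4 + W.b₂ * x ^ 3 + 3 * W.b₄ * x ^ 2 + 3 * W.b₆ * x + W.b₈ = 0 := by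
      rw [Affine.slope_of_Y_ne rfl hy, Affine.addX, hDeq]
      rw [hDeq] at hD
      rw [← neg_eq_zero (a := 3 * x ^ 4 + _ + _ + _ + _), ← key, ← sub_eq_zero]
      rw [show ∀ m D : F, D ≠ 0 → (m / D) ^ 2 + W.a₁ * (m / D) - W.a₂ - x - x - x =
          (m ^ 2 + W.a₁ * m * D - (W.a₂ + 3 * x) * D ^ 2) / D ^ 2 from fun m D hD => by
            field_simp; ring, div_eq_zero_iff, or_iff_left (pow_ne_zero 2 hD)]
      · exact hD
    rw [← hx, h3]
    constructor
    · intro h0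
      have h1 : P + P = -P := eq_neg_of_add_eq_zero_left h0
      rw [hadd, hP, Affine.Point.neg_some, Affine.Point.some.injEq] at h1
      exact h1.1
    · intro h0
      have h1 : P + P = P ∨ P + P = -P := by
        apply Affine.Point.eq_or_eq_neg_of_xRep_eq_xRep
        rw [hadd, hP, Affine.Point.xRep_some, Affine.Point.xRep_some, h0]
      rcases h1 with h1 | h1
      · exact absurd (add_eq_right.mp h1) hP0
      · rw [h1, neg_add_cancel]

theorem cube_resolvent_eq_discriminant {x y z w : F} (h2 : W.b₂ = -3 * (x + y + z + w))
    (h4 : W.b₄ = x * y + x * z + x * w + y * z + y * w + z * w)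
    (h6 : W.b₆ = -(x * y * z + x * y * w + x * z * w + y * z * w))
    (h8 : W.b₈ = 3 * (x * y * z * w)) :
    (W.b₄ - 3 * (x * y + z * w)) ^ 3 = W.Δ := by
  have hrel := W.b_relation
  rw [WeierstrassCurve.Δ]
  rw [h2, h4, h6, h8] at hrel ⊢
  linear_combination 9 * (x * z + x * w + y * z + y * w) * hrel

/-- The `x`-coordinates of the points of order 3 on an elliptic curve. -/
theorem exists_x_coords [DecidableEq F] [IsAlgClosed F] [CharZero F] [W.IsElliptic] : ∃ x : Fin 4 → F,
    (W.b₄ - 3 * (x 0 * x 1 + x 2 * x 3)) ^ 3 = W.Δ ∧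
    W.b₄ = x 0 * x 1 + x 0 * x 2 + x 0 * x 3 + x 1 * x 2 + x 1 * x 3 + x 2 * x 3 ∧
    (∀ i, 3 * x i ^ 4 + W.b₂ * x i ^ 3 + 3 * W.b₄ * x i ^ 2 + 3 * W.b₆ * x i + W.b₈ = 0) ∧
    (∀ i, ∃ y, ∃ h : W.Nonsingular (x i) y, 3 • Affine.Point.some (x i) y h = 0) ∧
    ∀ t y, ∀ h : W.Nonsingular t y, 3 • Affine.Point.some t y h = 0 → ∃ i, t = x i := by
  obtain ⟨x, y, z, w, h2, h4, h6, h8⟩ := exists_roots_quartic (W.b₂ / 3) W.b₄ W.b₆ (W.b₈ / 3)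
  have h2' : W.b₂ = -3 * (x + y + z + w) := by linear_combination 3 * h2
  have h8' : W.b₈ = 3 * (x * y * z * w) := by linear_combination 3 * h8
  have hfac : ∀ t, 3 * t ^ 4 + W.b₂ * t ^ 3 + 3 * W.b₄ * t ^ 2 + 3 * W.b₆ * t + W.b₈ =
      3 * ((t - x) * (t - y) * (t - z) * (t - w)) := by
    intro t; rw [h2', h4, h6, h8']; ring
  have hroot : ∀ i : Fin 4, 3 * (![x, y, z, w] i) ^ 4 + W.b₂ * (![x, y, z, w] i) ^ 3 +
      3 * W.b₄ * (![x, y, z, w] i) ^ 2 + 3 * W.b₆ * (![x, y, z, w] i) + W.b₈ = 0 := by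
    intro i; rw [hfac]; fin_cases i <;> simp
  refine ⟨![x, y, z, w], cube_resolvent_eq_discriminant h2' h4 h6 h8', h4, hroot, fun i => ?_,
    fun t y' h ht => ?_⟩
  · set t := ![x, y, z, w] i with ht
    obtain ⟨y', hy'⟩ := IsAlgClosed.exists_root
      (Polynomial.X ^ 2 + Polynomial.C (W.a₁ * t + W.a₃) * Polynomial.X -
        Polynomial.C (t ^ 3 + W.a₂ * t ^ 2 + W.a₄ * t + W.a₆) : Polynomial F) (by
        have : (Polynomial.X ^ 2 + Polynomial.C (W.a₁ * t + W.a₃) * Polynomial.X -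
          Polynomial.C (t ^ 3 + W.a₂ * t ^ 2 + W.a₄ * t + W.a₆) : Polynomial F).degree = 2 := by
          compute_degree!
        rw [this]; decide)
    simp only [Polynomial.IsRoot, Polynomial.eval_add, Polynomial.eval_mul, Polynomial.eval_pow,
      Polynomial.eval_X, Polynomial.eval_C, Polynomial.eval_sub] at hy'
    have hns : W.Nonsingular t y' := by
      rw [← Affine.equation_iff_nonsingular, Affine.equation_iff']
      linear_combination hy'
    exact ⟨y', hns, (three_nsmul_eq_zero_iff hns).mpr (hroot i)⟩
  · rw [three_nsmul_eq_zero_iff, hfac] at ht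
    have h3 : (3 : F) ≠ 0 := three_ne_zero
    simp only [mul_eq_zero, h3, false_or, sub_eq_zero] at ht
    rcases ht with ((ht | ht) | ht) | ht
    · exact ⟨0, ht⟩
    · exact ⟨1, ht⟩
    · exact ⟨2, ht⟩
    · exact ⟨3, ht⟩

end Curve

/-! ### Rational 2-torsion and cube discriminants -/

variable {E : WeierstrassCurve ℚ}

instance [E.IsElliptic] : (Affine.baseChange E Qbar).IsElliptic :=
  inferInstanceAs (E.map (algebraMap ℚ Qbar)).IsElliptic

theorem exists_rational_roots [E.IsElliptic] (hE : HasFullRationalTwoTorsion E) : ∃ e₁ e₂ e₃ : ℚ,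
    E.b₂ = -4 * (e₁ + e₂ + e₃) ∧ E.b₄ = 2 * (e₁ * e₂ + e₁ * e₃ + e₂ * e₃) ∧
      E.b₆ = -4 * (e₁ * e₂ * e₃) := by
  let W : Affine Qbar := Affine.baseChange E Qbar
  have hell : W.IsElliptic := inferInstanceAs (Affine.baseChange E Qbar).IsElliptic
  have hb2 : W.b₂ = algebraMap ℚ Qbar E.b₂ := E.map_b₂ _
  have hb4 : W.b₄ = algebraMap ℚ Qbar E.b₄ := E.map_b₄ _
  have hb6 : W.b₆ = algebraMap ℚ Qbar E.b₆ := E.map_b₆ _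
  obtain ⟨x, y, z, h2, h4, h6⟩ := exists_roots_cubic (W.b₂ / 4) (W.b₄ / 2) (W.b₆ / 4)
  have hrat : ∀ t, 4 * t ^ 3 + W.b₂ * t ^ 2 + 2 * W.b₄ * t + W.b₆ = 0 →
      ∃ e : ℚ, algebraMap ℚ Qbar e = t := by
    intro t ht
    -- This y-coordinate equals its own `negY`, so the point is killed by 2.
    have heq : W.Equation t (-(W.a₁ * t + W.a₃) / 2) := by
      rw [Affine.equation_iff']
      simp only [WeierstrassCurve.b₂, WeierstrassCurve.b₄, WeierstrassCurve.b₆] at ht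
      linear_combination -ht / 4
    have hns := Affine.equation_iff_nonsingular.mp heq
    have h2P : (2 : ℕ) • (Affine.Point.some _ _ hns : GeomPoint E) = 0 := by
      rw [two_nsmul]
      apply Affine.Point.add_self_of_Y_eq
      rw [Affine.negY]; ring
    obtain ⟨Q, hQ⟩ := hE _ h2P
    rcases Q with _ | ⟨u, v, huv⟩
    · exact absurd hQ.symm (Affine.Point.some_ne_zero hns)
    · exact ⟨u, (Affine.Point.some.inj hQ).1⟩
  have hfac : ∀ t, 4 * t ^ 3 + W.b₂ * t ^ 2 + 2 * W.b₄ * t + W.b₆ =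
      4 * ((t - x) * (t - y) * (t - z)) := by
    intro t
    linear_combination 4 * t ^ 2 * h2 + 4 * t * h4 + 4 * h6
  obtain ⟨e₁, rfl⟩ := hrat x (by rw [hfac]; ring)
  obtain ⟨e₂, rfl⟩ := hrat y (by rw [hfac]; ring)
  obtain ⟨e₃, rfl⟩ := hrat z (by rw [hfac]; ring)
  rw [hb2] at h2
  rw [hb4] at h4
  rw [hb6] at h6
  refine ⟨e₁, e₂, e₃, ?_, ?_, ?_⟩ <;> apply (algebraMap ℚ Qbar).injective <;>
    simp only [map_mul, map_add, map_neg, map_ofNat]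
  · linear_combination 4 * h2
  · linear_combination 2 * h4
  · linear_combination 4 * h6

theorem discriminant_eq {e₁ e₂ e₃ : ℚ} (h2 : E.b₂ = -4 * (e₁ + e₂ + e₃))
    (h4 : E.b₄ = 2 * (e₁ * e₂ + e₁ * e₃ + e₂ * e₃)) (h6 : E.b₆ = -4 * (e₁ * e₂ * e₃)) :
    E.Δ = 16 * ((e₁ - e₂) * (e₂ - e₃) * (e₁ - e₃)) ^ 2 := by
  have h8 : E.b₈ = 4 * ((e₁ + e₂ + e₃) * (e₁ * e₂ * e₃)) - (e₁ * e₂ + e₁ * e₃ + e₂ * e₃) ^ 2 := by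
    have := E.b_relation
    rw [h2, h4, h6] at this
    linear_combination this / 4
  rw [WeierstrassCurve.Δ, h2, h4, h6, h8]
  ring

/-- If the discriminant is a cube then the 2-torsion points are in arithmetic progression. -/
theorem exists_arithmetic_progression [E.IsElliptic] (hE : HasFullRationalTwoTorsion E) {r : ℚ}
    (hr : r ^ 3 = E.Δ) : ∃ e D : ℚ, D ≠ 0 ∧ E.b₂ = -12 * e ∧
      E.b₄ = 2 * (3 * e ^ 2 - D ^ 2) ∧ E.b₆ = -4 * (e * (e ^ 2 - D ^ 2)) ∧
      E.b₈ = 12 * (e ^ 2 * (e ^ 2 - D ^ 2)) - (3 * e ^ 2 - D ^ 2) ^ 2 := by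
  obtain ⟨e₁, e₂, e₃, h2, h4, h6⟩ := exists_rational_roots hE
  have hΔ := discriminant_eq h2 h4 h6
  have hΔ0 : E.Δ ≠ 0 := E.isUnit_Δ.ne_zero
  have hP : (e₁ - e₂) * (e₂ - e₃) * (e₁ - e₃) ≠ 0 := by
    intro h0; rw [h0] at hΔ; exact hΔ0 (by rw [hΔ]; ring)
  have hr0 : r ≠ 0 := by rintro rfl; exact hΔ0 (by rw [← hr]; ring)
  have h12 : e₁ - e₂ ≠ 0 := fun h => hP (by rw [h]; ring)
  have h23 : e₂ - e₃ ≠ 0 := fun h => hP (by rw [h]; ring)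
  have h13 : e₁ - e₃ ≠ 0 := fun h => hP (by rw [h]; ring)
  -- With p the product of the differences, r³ = 16p² gives (4p/r)³ = 4p.
  have hdio := cases_of_four_mul_mul_mul_add_eq_cube h12 h23 (by simpa using h13)
    (w := 4 * ((e₁ - e₂) * (e₂ - e₃) * (e₁ - e₃)) / r) (by
      rw [div_pow, eq_div_iff (pow_ne_zero 3 hr0), hr, hΔ]; ring)
  have finish : ∀ e D : ℚ, D ≠ 0 → E.b₂ = -12 * e →
      E.b₄ = 2 * (3 * e ^ 2 - D ^ 2) → E.b₆ = -4 * (e * (e ^ 2 - D ^ 2)) →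
      ∃ e D : ℚ, D ≠ 0 ∧ E.b₂ = -12 * e ∧
      E.b₄ = 2 * (3 * e ^ 2 - D ^ 2) ∧ E.b₆ = -4 * (e * (e ^ 2 - D ^ 2)) ∧
      E.b₈ = 12 * (e ^ 2 * (e ^ 2 - D ^ 2)) - (3 * e ^ 2 - D ^ 2) ^ 2 := by
    intro e D hD k2 k4 k6
    refine ⟨e, D, hD, k2, k4, k6, ?_⟩
    have := E.b_relation
    rw [k2, k4, k6] at this
    linear_combination this / 4
  rcases hdio with h | h | h
  · have e1 : e₁ = 2 * e₂ - e₃ := by linear_combination h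
    subst e1
    exact finish e₂ (e₂ - e₃) h23 (by rw [h2]; ring) (by rw [h4]; ring) (by rw [h6]; ring)
  · have e1 : e₂ = 2 * e₃ - e₁ := by linear_combination h
    subst e1
    exact finish e₃ (e₁ - e₃) h13 (by rw [h2]; ring) (by rw [h4]; ring) (by rw [h6]; ring)
  · have e1 : e₃ = 2 * e₁ - e₂ := by linear_combination -h
    subst e1
    exact finish e₁ (e₁ - e₂) h12 (by rw [h2]; ring) (by rw [h4]; ring) (by rw [h6]; ring)

/-! ### Galois action on the lines of E[3] -/

theorem torsionRep_coe (σ : GQ) (Q : Torsion E 3) :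
    (torsionRep E 3 σ Q : GeomPoint E) = galPoint E σ Q := rfl

theorem xRep_galPoint (σ : GQ) (P : GeomPoint E) : (galPoint E σ P).xRep = σ ∘ P.xRep := by
  rcases P with _ | ⟨x, y, h⟩
  · ext i
    change (0 : GeomPoint E).xRep i = σ ((0 : GeomPoint E).xRep i)
    fin_cases i <;> simp
  · ext i
    change ![σ x, 1] i = σ (![x, 1] i)
    fin_cases i <;> simp

/-- The `x`-coordinates of the points of order 3, with points realizing them. -/
structure ThreeTorsionData (E : WeierstrassCurve ℚ) where
  x : Fin 4 → Qbar
  P : Fin 4 → Torsion E 3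
  resolvent : ((E.b₄ : Qbar) - 3 * (x 0 * x 1 + x 2 * x 3)) ^ 3 = (E.Δ : Qbar)
  b₄_eq : (E.b₄ : Qbar) =
    x 0 * x 1 + x 0 * x 2 + x 0 * x 3 + x 1 * x 2 + x 1 * x 3 + x 2 * x 3
  root : ∀ i, 3 * x i ^ 4 + (E.b₂ : Qbar) * x i ^ 3 + 3 * (E.b₄ : Qbar) * x i ^ 2 +
    3 * (E.b₆ : Qbar) * x i + (E.b₈ : Qbar) = 0
  xRep_P : ∀ i, (P i : GeomPoint E).xRep = ![x i, 1]
  exists_xRep : ∀ Q : Torsion E 3, Q ≠ 0 → ∃ i, (Q : GeomPoint E).xRep = ![x i, 1]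

theorem nonempty_threeTorsionData (E : WeierstrassCurve ℚ) [E.IsElliptic] :
    Nonempty (ThreeTorsionData E) := by
  obtain ⟨x, h1, h2, h3, h4, h5⟩ := exists_x_coords (W := Affine.baseChange E Qbar)
  have hb2 : b₂ (Affine.baseChange E Qbar) = (E.b₂ : Qbar) := E.map_b₂ _
  have hb4 : b₄ (Affine.baseChange E Qbar) = (E.b₄ : Qbar) := E.map_b₄ _
  have hb6 : b₆ (Affine.baseChange E Qbar) = (E.b₆ : Qbar) := E.map_b₆ _
  have hb8 : b₈ (Affine.baseChange E Qbar) = (E.b₈ : Qbar) := E.map_b₈ _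
  have hΔ : Δ (Affine.baseChange E Qbar) = (E.Δ : Qbar) := E.map_Δ _
  rw [hb4] at h1 h2
  rw [hΔ] at h1
  simp only [hb2, hb4, hb6, hb8] at h3
  choose y h hP using h4
  refine ⟨⟨x, fun i => ⟨Affine.Point.some (x i) (y i) (h i),
    AddSubgroup.torsionBy.nsmul_iff.mpr (hP i)⟩, h1, h2, h3, fun i => rfl, ?_⟩⟩
  rintro ⟨Q, hQ⟩ hQ0
  rcases Q with _ | ⟨t, u, htu⟩
  · exact absurd rfl hQ0
  · obtain ⟨i, rfl⟩ := h5 t u htu (AddSubgroup.torsionBy.nsmul_iff.mp hQ)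
    exact ⟨i, rfl⟩

theorem zmod_three_cases : ∀ c : ZMod 3, c = 0 ∨ c = 1 ∨ c = -1 := by decide

theorem xRep_smul {c : ZMod 3} (hc : c ≠ 0) (Q : Torsion E 3) :
    ((c • Q : Torsion E 3) : GeomPoint E).xRep = (Q : GeomPoint E).xRep := by
  rcases zmod_three_cases c with rfl | rfl | rfl
  · exact absurd rfl hc
  · rw [one_smul]
  · rw [neg_smul, one_smul]; exact Affine.Point.xRep_neg _

namespace ThreeTorsionData

variable (d : ThreeTorsionData E)

theorem P_ne_zero (i : Fin 4) : d.P i ≠ 0 := by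
  intro h
  have := d.xRep_P i
  rw [h] at this
  have := congrFun this 1
  simp at this

/-- As Q and -Q share an x-coordinate, the `d.x i` label the lines of E[3]; an eigenvector of σ
gives a label fixed by σ. -/
theorem apply_x_eq_of_smul {σ : GQ} {Q : Torsion E 3} {c : ZMod 3}
    (h : torsionRep E 3 σ Q = c • Q) {i : Fin 4} (hQ : (Q : GeomPoint E).xRep = ![d.x i, 1]) :
    σ (d.x i) = d.x i := by
  have h1 := xRep_galPoint σ (Q : GeomPoint E)
  rw [← torsionRep_coe, h, hQ] at h1
  by_cases hc : c = 0
  · rw [hc, zero_smul] at h1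
    have := congrFun h1 1
    simp at this
  · rw [xRep_smul hc, hQ] at h1
    have := congrFun h1 0
    simpa using this.symm

theorem eq_or_eq_neg {Q R : Torsion E 3} (h : (Q : GeomPoint E).xRep = (R : GeomPoint E).xRep) :
    Q = R ∨ Q = -R :=
  (Affine.Point.eq_or_eq_neg_of_xRep_eq_xRep h).imp Subtype.ext fun h => Subtype.ext h

/-- Here g² maps each Q to ±Q. If g²Q = Q, then gQ + Q is either zero or a fixed vector, and in both
cases g has an eigenvector, hence fixes some `d.x i`. -/
theorem mul_self_eq_neg_one {g : GQ} (h1 : ∀ i, g (d.x i) ≠ d.x i)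
    (h2 : ∀ i, g (g (d.x i)) = d.x i) : torsionRep E 3 g * torsionRep E 3 g = -1 := by
  refine LinearMap.ext fun Q => ?_
  rw [Module.End.mul_apply, LinearMap.neg_apply, Module.End.one_apply]
  by_cases hQ : Q = 0
  · rw [hQ]; simp
  obtain ⟨i, hi⟩ := d.exists_xRep Q hQ
  have hx : ((torsionRep E 3 g (torsionRep E 3 g Q) : Torsion E 3) : GeomPoint E).xRep =
      (Q : GeomPoint E).xRep := by
    rw [torsionRep_coe, xRep_galPoint, torsionRep_coe, xRep_galPoint, hi]
    ext j
    fin_cases j <;> simp [h2]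
  refine (eq_or_eq_neg hx).resolve_left fun hfix => ?_
  have hR : torsionRep E 3 g (torsionRep E 3 g Q + Q) = (1 : ZMod 3) • (torsionRep E 3 g Q + Q) := by
    rw [map_add, hfix, one_smul, add_comm]
  by_cases hR0 : torsionRep E 3 g Q + Q = 0
  · have : torsionRep E 3 g Q = (-1 : ZMod 3) • Q := by
      rw [neg_smul, one_smul]; exact eq_neg_of_add_eq_zero_left hR0
    exact h1 i (d.apply_x_eq_of_smul this hi)
  · obtain ⟨j, hj⟩ := d.exists_xRep _ hR0
    exact h1 j (d.apply_x_eq_of_smul hR hj)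

/-- At most 1 + 2·4 = 9 points bound the rank by 2. In rank at most 1 all four x-coordinates agree,
so b₄ = 6x² and the resolvent vanishes, forcing Δ = 0. -/
theorem finrank_eq_two (d : ThreeTorsionData E) (hΔ : E.Δ ≠ 0) : Module.finrank (ZMod 3) (Torsion E 3) = 2 := by
  let f : Option (Fin 4 × Bool) → Torsion E 3 := fun o =>
    o.elim 0 fun p => if p.2 then d.P p.1 else -d.P p.1
  have hf : Function.Surjective f := by
    intro Q
    by_cases hQ : Q = 0
    · exact ⟨none, hQ.symm⟩
    obtain ⟨i, hi⟩ := d.exists_xRep Q hQ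
    rcases eq_or_eq_neg (hi.trans (d.xRep_P i).symm) with h | h
    · exact ⟨some (i, true), h.symm⟩
    · exact ⟨some (i, false), h.symm⟩
  have hfin : Finite (Torsion E 3) := Finite.of_surjective f hf
  have hcard : Nat.card (Torsion E 3) ≤ 9 := by
    have := Nat.card_le_card_of_surjective f hf
    simpa using this
  have hmf : Module.Finite (ZMod 3) (Torsion E 3) := Module.Finite.of_finite
  rw [Module.natCard_eq_pow_finrank (K := ZMod 3), Nat.card_zmod] at hcard
  have hle : Module.finrank (ZMod 3) (Torsion E 3) ≤ 2 :=
    (Nat.pow_le_pow_iff_right (by norm_num : 1 < 3)).mp (hcard.trans (by norm_num))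
  by_contra hne
  obtain ⟨v, hv⟩ := finrank_le_one_iff.mp
    (show Module.finrank (ZMod 3) (Torsion E 3) ≤ 1 by omega)
  have hx : ∀ i, d.x i = d.x 0 := by
    have : ∀ i, (v : GeomPoint E).xRep = ![d.x i, 1] := by
      intro i
      obtain ⟨c, hc⟩ := hv (d.P i)
      have hc0 : c ≠ 0 := by
        rintro rfl; exact d.P_ne_zero i (by rw [← hc, zero_smul])
      rw [← xRep_smul hc0, hc, d.xRep_P]
    intro i
    exact congrFun ((this i).symm.trans (this 0)) 0
  have h1 := d.resolvent
  have h2 := d.b₄_eq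
  simp only [hx 1, hx 2, hx 3] at h1 h2
  rw [h2] at h1
  apply hΔ
  have : (E.Δ : Qbar) = 0 := by rw [← h1]; ring
  exact_mod_cast this

end ThreeTorsionData

/-! ### Automorphisms acting on square roots -/

section Galois

theorem exists_rat_of_fixed {z : Qbar} (h : ∀ σ : GQ, σ z = z) : ∃ q : ℚ, (q : Qbar) = z :=
  IntermediateField.mem_bot.mp ((InfiniteGalois.mem_bot_iff_fixed z).mpr h)

theorem map_eq_or_eq_neg {a : Qbar} {q : ℚ} (ha : a ^ 2 = q) (σ : GQ) : σ a = a ∨ σ a = -a := by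
  apply sq_eq_sq_iff_eq_or_eq_neg.mp
  rw [← map_pow, ha, map_ratCast]

/-- If σ moves a and τ moves ab, one of σ, τ, τσ works. -/
theorem exists_map_eq_neg_and_map_eq {a b : Qbar} {p q : ℚ} (ha : a ^ 2 = p) (hb : b ^ 2 = q)
    (ha' : ∀ r : ℚ, (r : Qbar) ≠ a) (hab : ∀ r : ℚ, (r : Qbar) ≠ a * b) :
    ∃ σ : GQ, σ a = -a ∧ σ b = b := by
  obtain ⟨σ, hσ⟩ : ∃ σ : GQ, σ a ≠ a := by
    by_contra! h
    obtain ⟨r, hr⟩ := exists_rat_of_fixed h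
    exact ha' r hr
  have hσ := (map_eq_or_eq_neg ha σ).resolve_left hσ
  obtain ⟨τ, hτ⟩ : ∃ τ : GQ, τ (a * b) ≠ a * b := by
    by_contra! h
    obtain ⟨r, hr⟩ := exists_rat_of_fixed h
    exact hab r hr
  rcases map_eq_or_eq_neg hb σ with h1 | h1
  · exact ⟨σ, hσ, h1⟩
  rcases map_eq_or_eq_neg ha τ with h2 | h2 <;> rcases map_eq_or_eq_neg hb τ with h3 | h3
  · exact absurd (by rw [map_mul, h2, h3]) hτ
  · exact ⟨τ * σ, by rw [AlgEquiv.mul_apply, hσ, map_neg, h2],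
      by rw [AlgEquiv.mul_apply, h1, map_neg, h3, neg_neg]⟩
  · exact ⟨τ, h2, h3⟩
  · exact absurd (by rw [map_mul, h2, h3, neg_mul_neg]) hτ

theorem mem_fixingSubgroup_quadField {s : Qbar} (hs : s ^ 2 = -3) {σ : GQ} :
    σ ∈ (quadField 3).fixingSubgroup ↔ σ s = s := by
  have hset : ∀ x : Qbar, x ∈ {x : Qbar | x ^ 2 = (-1) ^ ((3 - 1) / 2) * ((3 : ℕ) : Qbar)} ↔
      x ^ 2 = -3 := by
    intro x
    rw [Set.mem_ofPred_eq]
    norm_num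
  constructor
  · intro h
    exact (IntermediateField.mem_fixingSubgroup_iff _ _).mp h s
      (IntermediateField.subset_adjoin ℚ _ ((hset s).mpr hs))
  · intro h
    have hle : quadField 3 ≤ IntermediateField.fixedField (Subgroup.zpowers σ) := by
      refine IntermediateField.adjoin_le_iff.mpr fun x hx => ?_
      have hx : x ^ 2 = s ^ 2 := ((hset x).mp hx).trans hs.symm
      have hσx : σ x = x := by
        rcases sq_eq_sq_iff_eq_or_eq_neg.mp hx with rfl | rfl
        · exact h
        · rw [map_neg, h]
      rintro ⟨τ, hτ⟩
      have : τ ∈ MulAction.stabilizer GQ x := by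
        refine (Subgroup.zpowers_le.mpr ?_) hτ
        exact hσx
      exact this
    exact (IntermediateField.le_iff_le _ _).mp hle (Subgroup.mem_zpowers σ)

theorem exists_sq_eq (q : Qbar) : ∃ s : Qbar, s ^ 2 = q :=
  (IsAlgClosed.exists_pow_nat_eq q two_pos)

instance normal_fixingSubgroup_quadField : (quadField 3).fixingSubgroup.Normal := by
  obtain ⟨s, hs⟩ := exists_sq_eq (-3)
  refine ⟨fun n hn g => ?_⟩
  rw [mem_fixingSubgroup_quadField hs] at hn ⊢
  have hg : g⁻¹ s = s ∨ g⁻¹ s = -s := map_eq_or_eq_neg (q := -3) (by rw [hs]; push_cast; rfl) _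
  rw [AlgEquiv.mul_apply, AlgEquiv.mul_apply]
  have hgg : g (g⁻¹ s) = s := by rw [← AlgEquiv.mul_apply, mul_inv_cancel, AlgEquiv.one_apply]
  have : n (g⁻¹ s) = g⁻¹ s := by
    rcases hg with h | h <;> rw [h]
    · exact hn
    · rw [map_neg, hn]
  rw [this, hgg]

end Galois

/-! ### Descending the cube root of Δ to ℚ -/

theorem cube_root_of_unity_cases {s ζ : Qbar} (hs : s ^ 2 = -3) (h : ζ ^ 3 = 1) :
    ζ = 1 ∨ ζ = (-1 + s) / 2 ∨ ζ = (-1 - s) / 2 := by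
  have : (ζ - 1) * ((ζ - (-1 + s) / 2) * (ζ - (-1 - s) / 2)) = 0 := by
    linear_combination h - (ζ - 1) * hs / 4
  rcases mul_eq_zero.mp this with h | h
  · exact .inl (sub_eq_zero.mp h)
  rcases mul_eq_zero.mp h with h | h
  · exact .inr (.inl (sub_eq_zero.mp h))
  · exact .inr (.inr (sub_eq_zero.mp h))

/-- If every automorphism fixing `√-3` has order dividing 8 on the 3-torsion, then the discriminant
is a cube. -/
theorem ThreeTorsionData.exists_cube_eq_discriminant (d : ThreeTorsionData E) (hΔ : E.Δ ≠ 0)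
    (h : ∀ σ ∈ (quadField 3).fixingSubgroup, torsionRep E 3 σ ^ 8 = 1) :
    ∃ r : ℚ, r ^ 3 = E.Δ := by
  obtain ⟨s, hs⟩ := exists_sq_eq (-3)
  have hsq : s ^ 2 = ((-3 : ℚ) : Qbar) := by rw [hs]; push_cast; rfl
  set θ : Qbar := (E.b₄ : Qbar) - 3 * (d.x 0 * d.x 1 + d.x 2 * d.x 3) with hθ
  have hθ3 : θ ^ 3 = (E.Δ : Qbar) := d.resolvent
  have hθ0 : θ ≠ 0 := by
    intro h0; rw [h0] at hθ3; apply hΔ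
    have : (E.Δ : Qbar) = 0 := by rw [← hθ3]; ring
    exact_mod_cast this
  have hfix : ∀ σ ∈ (quadField 3).fixingSubgroup, σ θ = θ := by
    intro σ hσ
    have hσs := (mem_fixingSubgroup_quadField hs).mp hσ
    have h8 : (σ ^ 8) θ = θ := by
      have hx : ∀ i, (σ ^ 8) (d.x i) = d.x i := fun i =>
        d.apply_x_eq_of_smul (Q := d.P i) (c := 1)
          (by rw [map_pow, h σ hσ, one_smul]; rfl) (d.xRep_P i)
      rw [hθ]
      simp only [map_sub, map_mul, map_add, map_ratCast, map_ofNat, hx]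
    -- ζ is a cube root of unity fixed by σ, so σ⁸θ = ζ⁸θ; since σ⁸ fixes θ, ζ³ = ζ⁸ = 1 and ζ = 1.
    set ζ := σ θ / θ with hζ
    have hσθ : σ θ = ζ * θ := by rw [hζ]; field_simp
    have hζ3 : ζ ^ 3 = 1 := by
      rw [hζ, div_pow, ← map_pow, hθ3, map_ratCast, div_self]
      rw [← hθ3]; exact pow_ne_zero 3 hθ0
    have hσζ : σ ζ = ζ := by
      rcases cube_root_of_unity_cases hs hζ3 with h | h | h <;> rw [h] <;>
        simp [hσs, map_ofNat]
    have hpow : ∀ n : ℕ, (σ ^ n) θ = ζ ^ n * θ := by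
      intro n
      induction n with
      | zero => simp
      | succ n ih => rw [pow_succ', AlgEquiv.mul_apply, ih, map_mul, map_pow, hσζ, hσθ]; ring
    have h1 : ζ ^ 8 = 1 := by
      have := (hpow 8).symm.trans h8
      exact mul_right_cancel₀ hθ0 (by rw [this, one_mul])
    have h2 : ζ = 1 := by
      linear_combination -ζ * h1 + (ζ ^ 6 + ζ ^ 3 + 1) * hζ3
    rw [hσθ, h2, one_mul]
  by_cases hall : ∀ σ : GQ, σ s = s
  · obtain ⟨r, hr⟩ := exists_rat_of_fixed (z := θ) fun σ =>
      hfix σ ((mem_fixingSubgroup_quadField hs).mpr (hall σ))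
    refine ⟨r, ?_⟩
    rw [← hr] at hθ3
    exact_mod_cast hθ3
  push Not at hall
  obtain ⟨τ, hτ⟩ := hall
  have hτs := (map_eq_or_eq_neg hsq τ).resolve_left hτ
  have hcoset : ∀ σ : GQ, σ s = -s → σ θ = τ θ := by
    intro σ hσ
    have hmem : τ⁻¹ * σ ∈ (quadField 3).fixingSubgroup := by
      rw [mem_fixingSubgroup_quadField hs, AlgEquiv.mul_apply, hσ, ← hτs, ← AlgEquiv.mul_apply,
        inv_mul_cancel, AlgEquiv.one_apply]
    have h1 := hfix _ hmem
    calc σ θ = τ ((τ⁻¹ * σ) θ) := by rw [← AlgEquiv.mul_apply, mul_inv_cancel_left]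
      _ = τ θ := by rw [h1]
  -- The norm r of θ from ℚ(√-3) satisfies r³ = Δ², so Δ/r is a rational cube root of Δ.
  obtain ⟨r, hr⟩ := exists_rat_of_fixed (z := θ * τ θ) fun σ => by
    rw [map_mul, ← AlgEquiv.mul_apply]
    rcases map_eq_or_eq_neg hsq σ with h1 | h1
    · rw [hfix σ ((mem_fixingSubgroup_quadField hs).mpr h1),
        hcoset (σ * τ) (by rw [AlgEquiv.mul_apply, hτs, map_neg, h1])]
    · rw [hcoset σ h1, hfix (σ * τ) ((mem_fixingSubgroup_quadField hs).mpr
        (by rw [AlgEquiv.mul_apply, hτs, map_neg, h1, neg_neg])), mul_comm]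
  have hr3 : (r : Qbar) ^ 3 = (E.Δ : Qbar) ^ 2 := by
    rw [hr, mul_pow, ← map_pow, hθ3, map_ratCast, sq]
  have hr3 : r ^ 3 = E.Δ ^ 2 := by exact_mod_cast hr3
  refine ⟨E.Δ / r, ?_⟩
  rw [div_pow, hr3]
  field_simp

theorem not_rat_sq_eq_three (r : ℚ) : r ^ 2 ≠ 3 := by
  intro h
  have h3 : IsSquare (3 : ℚ) := ⟨r, by rw [← h, sq]⟩
  have : IsSquare (3 : ℕ) := by exact_mod_cast (Rat.isSquare_natCast_iff (n := 3)).mp (by exact_mod_cast h3)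
  revert this
  rintro ⟨k, hk⟩
  have : k < 2 := by nlinarith
  interval_cases k <;> omega

/-! ### Twists of y² = x³ - x -/

section ArithmeticProgression

variable {i t : Qbar}

/-- The action of Galois on the roots of `3 * z ^ 4 - 6 * z ^ 2 - 1`. -/
theorem root_sq_map {z : Qbar} (ht : t ^ 2 = 3) (hz : 3 * z ^ 4 - 6 * z ^ 2 - 1 = 0) {σ : GQ}
    (hσt : σ t = -t) : σ z ^ 2 = 2 - z ^ 2 := by
  -- √3(z² - 1) = ±2 is rational, so negating √3 negates z² - 1.
  have hc : (t * (z ^ 2 - 1)) ^ 2 = 2 ^ 2 := by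
    linear_combination (z ^ 2 - 1) ^ 2 * ht + hz
  have hσc : σ (t * (z ^ 2 - 1)) = t * (z ^ 2 - 1) := by
    rcases sq_eq_sq_iff_eq_or_eq_neg.mp hc with h | h <;> rw [h] <;> simp [map_ofNat]
  simp only [map_mul, map_sub, map_pow, map_one, hσt] at hσc
  have ht0 : t ≠ 0 := by rintro rfl; norm_num at ht
  exact mul_left_cancel₀ ht0 (by linear_combination -hσc)

theorem root_ne_zero {z : Qbar} (hz : 3 * z ^ 4 - 6 * z ^ 2 - 1 = 0) : z ≠ 0 := by
  rintro rfl; norm_num at hz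

theorem root_map {z : Qbar} (hz : 3 * z ^ 4 - 6 * z ^ 2 - 1 = 0) (σ : GQ) :
    3 * σ z ^ 4 - 6 * σ z ^ 2 - 1 = 0 := by
  have := congrArg σ hz
  simpa [map_ofNat] using this

theorem root_map_ne {z : Qbar} (ht : t ^ 2 = 3) (hz : 3 * z ^ 4 - 6 * z ^ 2 - 1 = 0) {σ : GQ}
    (hσt : σ t = -t) : σ z ≠ z ∧ σ z ≠ -z := by
  have h := root_sq_map ht hz hσt
  have : σ z ^ 2 ≠ z ^ 2 := by
    intro h2
    rw [h] at h2
    have hz2 : z ^ 2 = 1 := by linear_combination -h2 / 2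
    have : (-4 : Qbar) = 0 := by linear_combination hz - (3 * z ^ 2 - 3) * hz2
    norm_num at this
  exact ⟨fun h1 => this (by rw [h1]), fun h1 => this (by rw [h1, neg_sq])⟩

/-- Since 3z²(2 - z²) = -1, the product √3·z·σz is ±i. Comparing it with its image -√3·σz·σ²z
determines σ²z from the action on i. -/
theorem root_map_map {z : Qbar} (hi : i ^ 2 = -1) (ht : t ^ 2 = 3)
    (hz : 3 * z ^ 4 - 6 * z ^ 2 - 1 = 0) {σ : GQ} (hσt : σ t = -t) :
    (σ i = i → σ (σ z) = -z) ∧ (σ i = -i → σ (σ z) = z) := by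
  have h := root_sq_map ht hz hσt
  have hj : (t * z * σ z) ^ 2 = i ^ 2 := by
    linear_combination t ^ 2 * z ^ 2 * h + z ^ 2 * (2 - z ^ 2) * ht - hz - hi
  have ht0 : t ≠ 0 := by rintro rfl; norm_num at ht
  have hσz : σ z ≠ 0 := root_ne_zero (root_map hz σ)
  have hne : t * σ z ≠ 0 := mul_ne_zero ht0 hσz
  constructor
  · intro hσi
    have hσj : σ (t * z * σ z) = t * z * σ z := by
      rcases sq_eq_sq_iff_eq_or_eq_neg.mp hj with h | h <;> rw [h] <;> simp [hσi]
    simp only [map_mul, hσt] at hσj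
    exact mul_left_cancel₀ hne (by linear_combination -hσj)
  · intro hσi
    have hσj : σ (t * z * σ z) = -(t * z * σ z) := by
      rcases sq_eq_sq_iff_eq_or_eq_neg.mp hj with h | h <;> rw [h] <;> simp [hσi]
    simp only [map_mul, hσt] at hσj
    exact mul_left_cancel₀ hne (by linear_combination -hσj)

variable [E.IsElliptic]

theorem ThreeTorsionData.exists_root_eq (d : ThreeTorsionData E)
    (hE : HasFullRationalTwoTorsion E) {r : ℚ} (hr : r ^ 3 = E.Δ) :
    ∃ (e D : ℚ) (z : Fin 4 → Qbar), D ≠ 0 ∧ ∀ j, 3 * z j ^ 4 - 6 * z j ^ 2 - 1 = 0 ∧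
      d.x j = e + D * z j := by
  obtain ⟨e, D, hD, h2, h4, h6, h8⟩ := exists_arithmetic_progression hE hr
  have hD' : (D : Qbar) ≠ 0 := by exact_mod_cast hD
  refine ⟨e, D, fun j => (d.x j - e) / D, hD, fun j => ?_⟩
  have hx : d.x j = e + D * ((d.x j - e) / D) := by field_simp; ring
  have hroot := d.root j
  refine ⟨?_, hx⟩
  beta_reduce
  generalize (d.x j - (e : Qbar)) / D = z at hx ⊢
  rw [hx, h2, h4, h6, h8] at hroot
  push_cast at hroot
  refine mul_left_cancel₀ (pow_ne_zero 4 hD') ?_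
  linear_combination hroot

theorem apply_eq_iff {e D : ℚ} {z w : Qbar} (hD : D ≠ 0) (σ : GQ) :
    σ (e + D * z) = e + D * w ↔ σ z = w := by
  have hD' : (D : Qbar) ≠ 0 := by exact_mod_cast hD
  simp [hD']

theorem exists_sqrts : ∃ i t : Qbar, i ^ 2 = -1 ∧ t ^ 2 = 3 ∧ (i * t) ^ 2 = -3 ∧
    (∃ σ : GQ, σ t = -t ∧ σ i = i) ∧ ∃ τ : GQ, τ t = -t ∧ τ i = -i := by
  obtain ⟨i, hi⟩ := exists_sq_eq (-1)
  obtain ⟨t, ht⟩ := exists_sq_eq 3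
  have hs : (i * t) ^ 2 = -3 := by rw [mul_pow, hi, ht]; ring
  have ht' : ∀ r : ℚ, (r : Qbar) ≠ t := by
    rintro r rfl
    exact not_rat_sq_eq_three r (by exact_mod_cast ht)
  have hneg : ∀ (q : ℚ) (a : Qbar), q < 0 → a ^ 2 = q → ∀ r : ℚ, (r : Qbar) ≠ a := by
    rintro q _ hq ha r rfl
    have : r ^ 2 = q := by exact_mod_cast ha
    nlinarith [sq_nonneg r]
  have ht0 : t ≠ 0 := by rintro rfl; norm_num at ht
  refine ⟨i, t, hi, ht, hs, exists_map_eq_neg_and_map_eq (p := 3) (q := -1) ?_ ?_ ht' ?_, ?_⟩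
  · rw [ht]; norm_num
  · rw [hi]; norm_num
  · exact hneg (-3) _ (by norm_num) (by rw [mul_comm, hs]; norm_num)
  · obtain ⟨τ, h1, h2⟩ := exists_map_eq_neg_and_map_eq (a := t) (b := i * t) (p := 3) (q := -3)
      (by rw [ht]; norm_num) (by rw [hs]; norm_num) ht'
      (hneg (-9) _ (by norm_num) (by rw [mul_pow, hs, ht]; norm_num))
    refine ⟨τ, h1, mul_right_cancel₀ ht0 ?_⟩
    rw [map_mul, h1] at h2
    linear_combination -h2

/-- If the discriminant is a cube, some automorphism acts on the subgroups of order 3 by a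
4-cycle. -/
theorem ThreeTorsionData.exists_sq_moves (d : ThreeTorsionData E)
    (hE : HasFullRationalTwoTorsion E) {r : ℚ} (hr : r ^ 3 = E.Δ) :
    ∃ σ : GQ, ∀ j, (σ * σ) (d.x j) ≠ d.x j := by
  obtain ⟨i, t, hi, ht, -, ⟨σ, hσt, hσi⟩, -⟩ := exists_sqrts
  obtain ⟨e, D, z, hD, hz⟩ := d.exists_root_eq hE hr
  refine ⟨σ, fun j => ?_⟩
  obtain ⟨hzj, hxj⟩ := hz j
  rw [hxj, Ne, apply_eq_iff hD, AlgEquiv.mul_apply, (root_map_map hi ht hzj hσt).1 hσi]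
  exact neg_ne_self.mpr (root_ne_zero hzj)

/-- On the roots, σ² is z ↦ -z, and τ and σ²τ are also involutions without fixed points. Each of the
three therefore squares to -1 on E[3], as in a quaternion group. τ negates both i and √3, so it
fixes √-3; σ² fixes both. -/
theorem isStronglyIrreducible_of_cube (hE : HasFullRationalTwoTorsion E) {r : ℚ}
    (hr : r ^ 3 = E.Δ) : IsStronglyIrreducible 3 (torsionRep E 3) := by
  obtain ⟨d⟩ := nonempty_threeTorsionData E
  obtain ⟨i, t, hi, ht, hs, ⟨σ, hσt, hσi⟩, ⟨τ, hτt, hτi⟩⟩ := exists_sqrts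
  obtain ⟨e, D, z, hD, hz⟩ := d.exists_root_eq hE hr
  have hσσ : ∀ w : Qbar, 3 * w ^ 4 - 6 * w ^ 2 - 1 = 0 → (σ * σ) w = -w := fun w hw =>
    (root_map_map hi ht hw hσt).1 hσi
  have hττ : ∀ w : Qbar, 3 * w ^ 4 - 6 * w ^ 2 - 1 = 0 → τ (τ w) = w := fun w hw =>
    (root_map_map hi ht hw hτt).2 hτi
  have key : ∀ g : GQ, (∀ w : Qbar, 3 * w ^ 4 - 6 * w ^ 2 - 1 = 0 → g w ≠ w) →
      (∀ w : Qbar, 3 * w ^ 4 - 6 * w ^ 2 - 1 = 0 → g (g w) = w) →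
      torsionRep E 3 g * torsionRep E 3 g = -1 := by
    intro g h1 h2
    refine d.mul_self_eq_neg_one (fun j => ?_) fun j => ?_
    · rw [(hz j).2, Ne, apply_eq_iff hD]
      exact h1 _ (hz j).1
    · rw [(hz j).2, (apply_eq_iff hD g).mpr rfl, apply_eq_iff hD]
      exact h2 _ (hz j).1
  have ha : σ * σ ∈ (quadField 3).fixingSubgroup := by
    rw [mem_fixingSubgroup_quadField hs]; simp [hσt, hσi]
  have hb : τ ∈ (quadField 3).fixingSubgroup := by
    rw [mem_fixingSubgroup_quadField hs]; simp [hτt, hτi]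
  refine isAbsolutelyIrreducible_of_quaternion (d.finrank_eq_two E.isUnit_Δ.ne_zero)
    ⟨σ * σ, ha⟩ ⟨τ, hb⟩ (key (σ * σ) (fun w hw => ?_) fun w hw => ?_)
    (key τ (fun w hw => (root_map_ne ht hw hτt).1) hττ) ?_
  · rw [hσσ w hw]; exact neg_ne_self.mpr (root_ne_zero hw)
  · rw [hσσ w hw, map_neg, hσσ w hw, neg_neg]
  · have := key (σ * σ * τ) (fun w hw => ?_) fun w hw => ?_
    · rw [map_mul] at this; exact this
    · rw [AlgEquiv.mul_apply, hσσ _ (root_map hw τ)]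
      intro h
      exact (root_map_ne ht hw hτt).2 (neg_eq_iff_eq_neg.mp h)
    · have h1 : (σ * σ * τ) w = -τ w := hσσ _ (root_map hw τ)
      rw [h1, map_neg, AlgEquiv.mul_apply, hττ w hw, hσσ w hw, neg_neg]

end ArithmeticProgression

/-! ### The two assertions -/

theorem matrixRep_val (b : Module.Basis (Fin 2) (ZMod 3) (Torsion E 3)) (σ : GQ) :
    (matrixRep E 3 b σ).val = LinearMap.toMatrix b b (torsionRep E 3 σ) := rfl

theorem not_range_le_normalizer [E.IsElliptic] (hE : HasFullRationalTwoTorsion E)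
    (b : Module.Basis (Fin 2) (ZMod 3) (Torsion E 3)) {C : Subgroup (GL (Fin 2) (ZMod 3))}
    (hC : IsSplitCartan C) :
    ¬ (matrixRep E 3 b).range ≤ Subgroup.normalizer (C : Set (GL (Fin 2) (ZMod 3))) := by
  intro hle
  have hmem : ∀ σ, matrixRep E 3 b σ ∈ Subgroup.normalizer (C : Set (GL (Fin 2) (ZMod 3))) :=
    fun σ => hle ⟨σ, rfl⟩
  obtain ⟨d⟩ := nonempty_threeTorsionData E
  obtain ⟨r, hr⟩ := d.exists_cube_eq_discriminant E.isUnit_Δ.ne_zero fun σ _ => by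
    obtain ⟨g, hg⟩ := hC.exists_conj_of_mem_normalizer
    have h4 := (hg _ (hmem σ)).2
    have h8 : matrixRep E 3 b (σ ^ 8) = 1 := by
      rw [map_pow, show 8 = 4 * 2 from rfl, pow_mul, h4, one_pow]
    have := congrArg Units.val h8
    rw [matrixRep_val, Units.val_one, ← LinearMap.toMatrix_one b] at this
    rw [← map_pow]
    exact (LinearMap.toMatrix b b).injective this
  obtain ⟨σ, hσ⟩ := d.exists_sq_moves hE hr
  obtain ⟨v, hv0, c, hc⟩ := hC.exists_eigenvector_sq (hmem σ)
  rw [sq, ← map_mul, matrixRep_val] at hc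
  set Q := b.equivFun.symm v with hQ
  have hv : v = b.repr Q := by
    rw [hQ]; exact (b.equivFun.apply_symm_apply v).symm
  have hQ0 : Q ≠ 0 := by
    intro h0; apply hv0; rw [hv, h0]; simp
  have hQc : torsionRep E 3 (σ * σ) Q = c • Q := by
    apply b.repr.injective
    ext j
    have := congrFun hc j
    rw [hv, LinearMap.toMatrix_mulVec_repr] at this
    simpa using this
  obtain ⟨j, hj⟩ := d.exists_xRep Q hQ0
  exact hσ j (d.apply_x_eq_of_smul hQc hj)

theorem isStronglyIrreducible_of_isIrreducible [E.IsElliptic] (hE : HasFullRationalTwoTorsion E)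
    (hirr : (torsionRep E 3).IsIrreducible) : IsStronglyIrreducible 3 (torsionRep E 3) := by
  obtain ⟨d⟩ := nonempty_threeTorsionData E
  have hrank := d.finrank_eq_two E.isUnit_Δ.ne_zero
  by_cases hall : ∀ σ ∈ (quadField 3).fixingSubgroup, torsionRep E 3 σ ^ 8 = 1
  · obtain ⟨r, hr⟩ := d.exists_cube_eq_discriminant E.isUnit_Δ.ne_zero hall
    exact isStronglyIrreducible_of_cube hE hr
  push Not at hall
  obtain ⟨σ, hσ, h8⟩ := hall
  have h6 : torsionRep E 3 σ ^ 6 = 1 := by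
    rcases end_zmod_three_pow_eq_one hrank ((torsionRep E 3).toHomUnits σ) with h | h
    · exact absurd (congrArg Units.val h) h8
    · exact congrArg Units.val h
  -- σ² acts with cube 1, and nontrivially, since otherwise σ⁸ would act trivially.
  refine isAbsolutelyIrreducible_of_order_three hrank hirr (quadField 3).fixingSubgroup
    (h := σ ^ 2) (pow_mem hσ 2) ?_ ?_
  · rw [map_pow, ← pow_mul]; exact h6
  · intro h
    rw [map_pow] at h
    apply h8
    rw [show 8 = 2 * 4 from rfl, pow_mul, h, one_pow]

end EllipticGalois

theorem corollary3p3 (E : WeierstrassCurve ℚ) [E.IsElliptic]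
    (hE : EllipticGalois.HasFullRationalTwoTorsion E) :
    (∀ (b : Module.Basis (Fin 2) (ZMod 3) (EllipticGalois.Torsion E 3))
      (C : Subgroup (GL (Fin 2) (ZMod 3))), EllipticGalois.IsSplitCartan C →
        ¬ (EllipticGalois.matrixRep E 3 b).range ≤
          Subgroup.normalizer (C : Set (GL (Fin 2) (ZMod 3)))) ∧
    ((EllipticGalois.torsionRep E 3).IsIrreducible →
      EllipticGalois.IsStronglyIrreducible 3 (EllipticGalois.torsionRep E 3)) :=
  ⟨fun b _ hC => EllipticGalois.not_range_le_normalizer hE b hC,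
    EllipticGalois.isStronglyIrreducible_of_isIrreducible hE⟩
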